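/- For a random variable $X$ taking finitely many integer values, with probability mass function $p(x)=\mathbb{P}(X=x)$, define its Rényi entropy of order $\alpha\in[0,\infty)$ by $$H_\alpha(X)=\frac{1}{1-\alpha}\log\Big(\sum_{x:\,p(x)>0}p(x)^\alpha\Big)\quad(\alpha\neq 0,1),$$ $$H_0(X)=\log\big|\{x:p(x)>0\}\big|,\qquad H_1(X)=-\sum_{x:\,p(x)>0}p(x)\log p(x),$$ and its Rényi entropy power by $N_\alpha(X)=e^{2H_\alpha(X)}$. Let $\alpha\in[0,2]$ and let $n\ge 1$ be an integer. Let $U_1,\dots,U_n$ be independent random variables such that, for each $k$, $U_k$ is uniformly distributed on some nonempty finite set $S_k\subset\mathbb{Z}$ (the sets $S_k$ are arbitrary and may differ). Then $$N_\alpha\Big(\sum_{k=1}^n U_k\Big)\;\ge\;\sum_{k=1}^n N_\alpha(U_k)-(n-1).$$ -/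

import Mathlib

open MeasureTheory ProbabilityTheory

/-- The probability mass function `x ↦ μ (X = x)` of a random variable `X` under `μ`. -/
noncomputable def probMass {Ω I : Type*} [MeasurableSpace Ω] (μ : Measure Ω) (X : Ω → I) (x : I) : ℝ :=
  μ.real (X ⁻¹' {x})

/-- The Rényi entropy of finite order `α ≥ 0` of a discrete random variable `X` with finite support,
with probability mass function `p`:
`log |supp p|` for `α = 0`, the Shannon entropy `-∑ p log p` for `α = 1`,
and `(1 - α)⁻¹ log ∑ p ^ α` otherwise. As `p` has finite support, the infinite sums are finite ones. -/
noncomputable def renyiEntropy {Ω I : Type*} [MeasurableSpace Ω] (α : ℝ) (μ : Measure Ω) (X : Ω → I) : ℝ :=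
  if α = 0 then Real.log ((Function.support (probMass μ X)).ncard : ℝ)
  else if α = 1 then - ∑' x, probMass μ X x * Real.log (probMass μ X x)
  else 1 / (1 - α) * Real.log (∑' x, probMass μ X x ^ α)

/-- The Rényi entropy power `N_α(X) = exp (2 H_α(X))`. -/
noncomputable def renyiEntropyPower {Ω I : Type*} [MeasurableSpace Ω] (α : ℝ) (μ : Measure Ω)
    (X : Ω → I) : ℝ :=
  Real.exp (2 * renyiEntropy α μ X)

/-!
The Rényi entropy is nonincreasing in its order, and a uniform variable on `m` points has entropy
power `m ^ 2` for every order. It therefore suffices to bound the collision probability of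
`X = ∑ U_k`, namely `∑ₓ P(X = x)² ≤ (1 + ∑ (m_k² - 1))^(-1/2)` with `m_k = |S_k|`.

*Rearrangement.* Up to normalisation the collision probability is the number of representations of
`0` by `S₁, -S₁, S₂, -S₂, …`. Among sets of given sizes, intervals maximise such a count
(`repCount_le_interval`). The reason is that in a product `A × B` the pairs involving `min A` or
`min B` have distinct differences, and peeling them off repeatedly cuts `A × B` into pieces of
sizes `|A| + |B| - 1, |A| + |B| - 3, …`, which are nested concentric intervals of differences if
`A` and `B` are intervals. For intervals the count is a Fourier integral of a product of Fejér
kernels `f_m(θ) = (sin (m θ) / (m sin θ))²` (`integral_prod_fejer`).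

*Hölder.* With weights proportional to `m_k² - 1`, Hölder's inequality
(`integral_prod_fejer_le`) reduces the bound to a discrete form of Ball's integral inequality,
`(1/π) ∫₀^π f_m^q ≤ (1 + q (m² - 1))^(-1/2)` for real `q ≥ 1` and `m ≥ 2`
(`integral_fejer_rpow_le`). There is equality at `q = 1`, because `∫ f_m = π / m`, so the estimates
have to retain this normalisation. Write `q = 1 + p`.

* For `m = 2` the integral is `B(q - 1/2)` up to a constant, with `B(r) = ∫₀¹ (1 - x²)^r dx`. The
  recurrence for `B` shows that `B(r)² (3 r + 5/2)` is nonincreasing (`betaHalf_sq_mul_le`).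
* For `m ≥ 3` let `E` be the `p`-th power of a bound for `f_m` on the side lobes and write
  `f^(1+p) = E f + f (f^p - E)`. The first term is integrated exactly. The second one is nonpositive
  on the side lobes, while on the main lobe both `f` and `f^p` are replaced by explicit majorants.
  For `m = 3` these are powers of `1 - (4/3) sin² θ`, which again lead to `B`
  (`integral_fejer_three`); for `m ≥ 4` they are Gaussians (`integral_fejer_large`).
-/

/-! ### Rearrangement of representation counts -/

/-- `repCount [A₁, …, Aₙ] y` is the number of tuples `(a₁, …, aₙ) ∈ A₁ × ⋯ × Aₙ` with sum `y`. -/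
def repCount : List (Finset ℤ) → ℤ → ℕ
  | [], y => if y = 0 then 1 else 0
  | A :: L, y => ∑ a ∈ A, repCount L (y - a)

/-- Peeling recursion for `A × B` with `|A| = m`, `|B| = k`: the pairs using the least element of
`A` or of `B` contribute `m + k - 1` distinct differences, to which `f` is applied; the remaining
pairs form a product of sizes `m - 1` and `k - 1`. -/
def hookSum (f : ℕ → ℕ) : ℕ → ℕ → ℕ
  | 0, _ => 0
  | _ + 1, 0 => 0
  | m + 1, k + 1 => f (m + k + 1) + hookSum f m k

/-- The largest number of tuples in a product of sets of sizes `m₁, …, mₙ` whose sum lies in a set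
of size `k`; it is attained by intervals, see `sum_repCount_interval`. -/
def maxRepCount : List ℕ → ℕ → ℕ
  | [], k => min 1 k
  | m :: l, k => hookSum (maxRepCount l) m k

/-- One step of the rearrangement. The differences `b - a` with `a = min A` or `b = min B` are
pairwise distinct, so that `h` summed over them is controlled by `H`; the remaining pairs are
handled by induction. -/
lemma sum_sum_sub_le_hookSum {f : ℕ → ℕ} {h : ℤ → ℕ}
    (H : ∀ R : Finset ℤ, ∑ s ∈ R, h s ≤ f R.card) (m : ℕ) :
    ∀ A B : Finset ℤ, A.card = m →
      ∑ b ∈ B, ∑ a ∈ A, h (b - a) ≤ hookSum f m B.card := by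
  induction m with
  | zero =>
    intro A B hA
    simp [Finset.card_eq_zero.mp hA]
  | succ m ih =>
    intro A B hA
    rcases B.eq_empty_or_nonempty with rfl | hB
    · simp
    have hAne : A.Nonempty := Finset.card_pos.mp (by omega)
    set a₀ := A.min' hAne with ha₀
    set b₀ := B.min' hB with hb₀
    have ha : a₀ ∈ A := A.min'_mem hAne
    have hb : b₀ ∈ B := B.min'_mem hB
    have hAc : (A.erase a₀).card = m := by rw [Finset.card_erase_of_mem ha]; omega
    obtain ⟨k, hk⟩ : ∃ k, B.card = k + 1 := ⟨B.card - 1, by have := hB.card_pos; omega⟩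
    have hBc : (B.erase b₀).card = k := by rw [Finset.card_erase_of_mem hb]; omega
    have key := ih (A.erase a₀) (B.erase b₀) hAc
    rw [hBc] at key
    have hdisj : Disjoint (B.image (fun b => b - a₀)) ((A.erase a₀).image (fun a => b₀ - a)) := by
      rw [Finset.disjoint_left]
      intro s hs hs'
      obtain ⟨b, hb', rfl⟩ := Finset.mem_image.mp hs
      obtain ⟨a, ha', hab⟩ := Finset.mem_image.mp hs'
      have h1 : b₀ ≤ b := B.min'_le b hb'
      have h2 : a₀ ≤ a := A.min'_le a (Finset.mem_of_mem_erase ha')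
      exact (Finset.ne_of_mem_erase ha') (by omega)
    have hR := H (B.image (fun b => b - a₀) ∪ (A.erase a₀).image (fun a => b₀ - a))
    rw [Finset.sum_union hdisj, Finset.card_union_of_disjoint hdisj,
      Finset.card_image_of_injective _ (sub_left_injective),
      Finset.card_image_of_injective _ (sub_right_injective), hAc, hk,
      Finset.sum_image (fun x _ y _ hxy => by simpa using hxy),
      Finset.sum_image (fun x _ y _ hxy => by simpa using hxy)] at hR
    have hsplit : ∑ b ∈ B, ∑ a ∈ A, h (b - a) =
        (∑ b ∈ B, h (b - a₀) + ∑ a ∈ A.erase a₀, h (b₀ - a))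
          + ∑ b ∈ B.erase b₀, ∑ a ∈ A.erase a₀, h (b - a) := by
      have h1 := Finset.sum_erase_add B (fun b => ∑ a ∈ A.erase a₀, h (b - a)) hb
      have h2 : ∀ b ∈ B, ∑ a ∈ A, h (b - a) = h (b - a₀) + ∑ a ∈ A.erase a₀, h (b - a) :=
        fun b _ => by rw [add_comm, Finset.sum_erase_add _ _ ha]
      rw [Finset.sum_congr rfl h2, Finset.sum_add_distrib, ← h1]
      ring
    rw [hsplit, hk, hookSum, show m + k + 1 = k + 1 + m by ring]
    exact add_le_add hR key

lemma sum_repCount_cons (A : Finset ℤ) (L : List (Finset ℤ)) (B : Finset ℤ) :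
    ∑ y ∈ B, repCount (A :: L) y = ∑ b ∈ B, ∑ a ∈ A, repCount L (b - a) := rfl

/-- Discrete rearrangement inequality, upper bound. -/
theorem sum_repCount_le (L : List (Finset ℤ)) (B : Finset ℤ) :
    ∑ y ∈ B, repCount L y ≤ maxRepCount (L.map Finset.card) B.card := by
  induction L generalizing B with
  | nil =>
    simp only [repCount, List.map_nil, maxRepCount, Finset.sum_ite_eq']
    split_ifs with h
    · have := Finset.card_pos.mpr ⟨_, h⟩
      omega
    · simp
  | cons A L ih =>
    rw [sum_repCount_cons]
    exact sum_sum_sub_le_hookSum (fun R => ih R) A.card A B rfl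

/-- For intervals the peeled differences form an interval with the same centre, so that the estimate
`sum_sum_sub_le_hookSum` is an equality. The tolerance `1` in the hypothesis accounts for
intervals that cannot be centred exactly for reasons of parity. -/
lemma sum_sum_sub_Ico {f : ℕ → ℕ} {h : ℤ → ℕ} {N : ℤ}
    (H : ∀ (r : ℤ) (k : ℕ), |2 * r + k - 1 - N| ≤ 1 → ∑ s ∈ Finset.Ico r (r + k), h s = f k)
    (m : ℕ) : ∀ (k : ℕ) (a b : ℤ), |(2 * b + k - 1) - (2 * a + m - 1) - N| ≤ 1 →
      ∑ y ∈ Finset.Ico b (b + k), ∑ x ∈ Finset.Ico a (a + m), h (y - x) = hookSum f m k := by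
  induction m with
  | zero => intro k a b _; simp [hookSum]
  | succ m ih =>
    intro k a b hab
    rcases k with _ | k
    · simp [hookSum]
    have key := ih k (a + 1) (b + 1) (by push_cast at hab ⊢; convert hab using 2; ring)
    have hR := H (b - (a + m)) (m + k + 1) (by push_cast at hab ⊢; convert hab using 2; ring)
    have hA : Finset.Ico a (a + ((m + 1 : ℕ) : ℤ)) = insert a (Finset.Ico (a + 1) (a + 1 + m)) := by
      ext; simp; omega
    have hB : Finset.Ico b (b + ((k + 1 : ℕ) : ℤ)) = insert b (Finset.Ico (b + 1) (b + 1 + k)) := by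
      ext; simp; omega
    have hU : Finset.Ico (b - (a + m)) (b - (a + m) + ((m + k + 1 : ℕ) : ℤ)) =
        (insert b (Finset.Ico (b + 1) (b + 1 + k))).image (fun y => y - a) ∪
          (Finset.Ico (a + 1) (a + 1 + m)).image (fun x => b - x) := by
      ext s
      simp only [Finset.mem_Ico, Finset.mem_union, Finset.mem_image, Finset.mem_insert]
      constructor
      · intro hs
        by_cases h' : b - a ≤ s
        · exact Or.inl ⟨s + a, by push_cast at hs; omega, by ring⟩
        · exact Or.inr ⟨b - s, by push_cast at hs; omega, by ring⟩
      · rintro (⟨y, hy, rfl⟩ | ⟨x, hx, rfl⟩) <;> push_cast <;> omega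
    have hdisj : Disjoint ((insert b (Finset.Ico (b + 1) (b + 1 + k))).image (fun y => y - a))
        ((Finset.Ico (a + 1) (a + 1 + m)).image (fun x => b - x)) := by
      rw [Finset.disjoint_left]
      intro s hs hs'
      simp only [Finset.mem_Ico, Finset.mem_image, Finset.mem_insert] at hs hs'
      omega
    rw [hU, Finset.sum_union hdisj, Finset.sum_image (fun x _ y _ hxy => by simpa using hxy),
      Finset.sum_image (fun x _ y _ hxy => by simpa using hxy)] at hR
    rw [hookSum, ← hR, ← key, hA, hB]
    have ha : a ∉ Finset.Ico (a + 1) (a + 1 + (m : ℤ)) := by simp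
    have hb : b ∉ Finset.Ico (b + 1) (b + 1 + (k : ℤ)) := by simp
    simp only [Finset.sum_insert ha, Finset.sum_insert hb, Finset.sum_add_distrib]
    ring

/-- Centred intervals attain the bound of `sum_repCount_le`. -/
theorem sum_repCount_interval (l : List ℕ) (k : ℕ) (b : ℤ)
    (hb : |2 * b + k - 1 - (l.map (fun m : ℕ => (m : ℤ) - 1)).sum| ≤ 1) :
    ∑ y ∈ Finset.Ico b (b + k), repCount (l.map fun m : ℕ => Finset.Ico 0 (m : ℤ)) y =
      maxRepCount l k := by
  induction l generalizing k b with
  | nil =>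
    simp only [List.map_nil, List.sum_nil, abs_le, repCount, maxRepCount, Finset.sum_ite_eq',
      Finset.mem_Ico] at hb ⊢
    split_ifs with h <;> omega
  | cons m l ih =>
    simp only [List.map_cons, List.sum_cons] at hb ⊢
    rw [sum_repCount_cons, maxRepCount]
    have := sum_sum_sub_Ico (h := repCount (l.map fun m : ℕ => Finset.Ico 0 (m : ℤ)))
      (f := maxRepCount l) (N := (l.map (fun m : ℕ => (m : ℤ) - 1)).sum)
      (fun r k hr => ih k r hr) m k 0 b (by convert hb using 2; ring)
    simpa using this

/-- Among sets of prescribed sizes, intervals maximise the largest representation count. -/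
theorem repCount_le_interval (L : List (Finset ℤ)) (x y : ℤ)
    (hy : 2 * y = (L.map (fun A => (A.card : ℤ) - 1)).sum) :
    repCount L x ≤ repCount (L.map fun A => Finset.Ico 0 (A.card : ℤ)) y := by
  have h1 := sum_repCount_le L {x}
  have h2 := sum_repCount_interval (L.map Finset.card) 1 y (by
    rw [List.map_map]
    simp only [Function.comp_def]
    rw [← hy]; simp)
  have h3 : Finset.Ico y (y + (1 : ℕ)) = {y} := by ext; simp; omega
  rw [h3, List.map_map] at h2
  simp only [Finset.sum_singleton, Finset.card_singleton, Function.comp_def] at h1 h2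
  exact h1.trans h2.ge

lemma finite_support_repCount (L : List (Finset ℤ)) : (Function.support (repCount L)).Finite := by
  induction L with
  | nil =>
    refine (Set.finite_singleton (0 : ℤ)).subset fun y hy => ?_
    by_contra h
    exact hy (by simp_all [repCount])
  | cons A L ih =>
    refine ((A.finite_toSet).biUnion fun a _ => ih.image (· + a)).subset fun y hy => ?_
    obtain ⟨a, ha, h⟩ := Finset.exists_ne_zero_of_sum_ne_zero hy
    exact Set.mem_biUnion ha ⟨y - a, h, by simp⟩

/-- The list `[A₁, -A₁, A₂, -A₂, …]`. -/
def symmetrize : List (Finset ℤ) → List (Finset ℤ)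
  | [] => []
  | A :: L => A :: A.image (fun a => -a) :: symmetrize L

/-- The autocorrelation of `repCount L` counts the representations by the symmetrized list. -/
lemma tsum_repCount_mul (L : List (Finset ℤ)) (y : ℤ) :
    ∑' x, (repCount L x : ℝ) * repCount L (x + y) = repCount (symmetrize L) y := by
  induction L generalizing y with
  | nil =>
    rw [tsum_eq_single 0 (fun x hx => by simp [repCount, hx])]
    simp [repCount, symmetrize]
  | cons A L ih =>
    have hsum : ∀ y : ℤ, Summable fun x => (repCount L x : ℝ) * repCount L (x + y) := fun y =>
      summable_of_hasFiniteSupport ((finite_support_repCount L).subset fun x hx => by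
        intro h; exact hx (by simp [h]))
    have hshift : ∀ a b : ℤ, (fun x : ℤ => (repCount L (x - a) : ℝ) * repCount L (x + y - b)) =
        (fun x => (repCount L x : ℝ) * repCount L (x + (y + a - b))) ∘ (Equiv.subRight a) := by
      intro a b
      funext x
      simp only [Function.comp, Equiv.subRight_apply]
      rw [show x - a + (y + a - b) = x + y - b by ring]
    simp only [repCount, symmetrize, Nat.cast_sum, Finset.sum_mul_sum]
    rw [Summable.tsum_finsetSum (fun a _ => summable_sum fun b _ => by
      rw [hshift]; exact (Equiv.summable_iff _).mpr (hsum _))]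
    rw [Finset.sum_congr rfl fun a _ => Summable.tsum_finsetSum (fun b _ => by
      rw [hshift]; exact (Equiv.summable_iff _).mpr (hsum _))]
    have h1 : ∀ a b : ℤ, ∑' x : ℤ, (repCount L (x - a) : ℝ) * repCount L (x + y - b) =
        repCount (symmetrize L) (y + a - b) := by
      intro a b
      rw [hshift, ← ih]
      exact (Equiv.subRight a).tsum_eq (fun x => (repCount L x : ℝ) * repCount L (x + (y + a - b)))
    simp only [h1]
    rw [Finset.sum_comm]
    refine Finset.sum_congr rfl fun b _ => ?_
    rw [Finset.sum_image (fun x _ y _ hxy => by simpa using hxy)]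
    exact Finset.sum_congr rfl fun a _ => by rw [show y - b - -a = y + a - b by ring]

/-- The list `[m₁, m₁, m₂, m₂, …]`. -/
def duplicate : List ℕ → List ℕ
  | [] => []
  | m :: l => m :: m :: duplicate l

lemma map_card_symmetrize (L : List (Finset ℤ)) :
    (symmetrize L).map Finset.card = duplicate (L.map Finset.card) := by
  induction L with
  | nil => rfl
  | cons A L ih =>
    simp [symmetrize, duplicate, ih, Finset.card_image_of_injective _ neg_injective]

lemma sum_duplicate (l : List ℕ) :
    ((duplicate l).map (fun m : ℕ => (m : ℤ) - 1)).sum =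
      2 * (l.map (fun m : ℕ => (m : ℤ) - 1)).sum := by
  induction l with
  | nil => simp [duplicate]
  | cons m l ih => simp [duplicate, ih]; ring

/-- The collision count of a sum is largest for intervals. -/
theorem tsum_repCount_sq_le (L : List (Finset ℤ)) :
    ∑' x, (repCount L x : ℝ) ^ 2 ≤
      repCount ((duplicate (L.map Finset.card)).map fun m : ℕ => Finset.Ico 0 (m : ℤ))
        ((L.map Finset.card).map (fun m : ℕ => (m : ℤ) - 1)).sum := by
  have h := tsum_repCount_mul L 0
  simp only [add_zero, ← pow_two] at h
  rw [h]
  have := repCount_le_interval (symmetrize L) 0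
    ((L.map Finset.card).map (fun m : ℕ => (m : ℤ) - 1)).sum (by
      rw [← sum_duplicate, ← map_card_symmetrize, List.map_map]; rfl)
  rw [← map_card_symmetrize, List.map_map]
  exact_mod_cast this

/-! ### Representation counts as Fourier integrals -/

/-- The character `θ ↦ exp (2 i k θ)`, of period `π`. -/
noncomputable def char2 (k : ℤ) (θ : ℝ) : ℂ := Complex.exp (2 * k * θ * Complex.I)

lemma char2_add (j k : ℤ) (θ : ℝ) : char2 (j + k) θ = char2 j θ * char2 k θ := by
  rw [char2, char2, char2, ← Complex.exp_add]
  push_cast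
  ring_nf

lemma continuous_char2 (k : ℤ) : Continuous (char2 k) := by
  unfold char2
  fun_prop

lemma integral_char2 (k : ℤ) :
    ∫ θ in (0 : ℝ)..Real.pi, char2 k θ = if k = 0 then (Real.pi : ℂ) else 0 := by
  split_ifs with h
  · simp [h, char2]
  · have hk : (2 * k * Complex.I : ℂ) ≠ 0 := by simp [h]
    have : ∀ θ : ℝ, char2 k θ = Complex.exp (2 * k * Complex.I * θ) := fun θ => by
      rw [char2]; ring_nf
    simp only [this]
    rw [integral_exp_mul_complex hk]
    have h1 : Complex.exp (2 * k * Complex.I * Real.pi) = 1 := by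
      rw [show (2 * k * Complex.I * Real.pi : ℂ) = k * (2 * Real.pi * Complex.I) by ring]
      exact Complex.exp_int_mul_two_pi_mul_I k
    simp [h1]

/-- Representation counts are Fourier coefficients of products of exponential sums. -/
lemma integral_char2_mul_prod (L : List (Finset ℤ)) (y : ℤ) :
    ∫ θ in (0 : ℝ)..Real.pi, char2 (-y) θ * (L.map fun A => ∑ a ∈ A, char2 a θ).prod =
      Real.pi * repCount L y := by
  induction L generalizing y with
  | nil => simp [integral_char2, repCount]
  | cons A L ih =>
    have hc : Continuous fun θ => (L.map fun A => ∑ a ∈ A, char2 a θ).prod :=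
      continuous_list_prod _ fun A _ => continuous_finsetSum _ fun a _ => continuous_char2 a
    have h1 : ∀ θ, char2 (-y) θ * ((A :: L).map fun A => ∑ a ∈ A, char2 a θ).prod =
        ∑ a ∈ A, char2 (-(y - a)) θ * (L.map fun A => ∑ a ∈ A, char2 a θ).prod := by
      intro θ
      rw [List.map_cons, List.prod_cons, ← mul_assoc, Finset.mul_sum, Finset.sum_mul]
      refine Finset.sum_congr rfl fun a _ => ?_
      rw [← char2_add]
      ring_nf
    simp only [h1]
    have hint : ∀ a ∈ A, IntervalIntegrable (fun θ => char2 (-(y - a)) θ *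
        (L.map fun A => ∑ a ∈ A, char2 a θ).prod) volume 0 Real.pi := fun a _ =>
      ((continuous_char2 _).mul hc).intervalIntegrable _ _
    rw [intervalIntegral.integral_finsetSum hint]
    simp only [ih, repCount, Nat.cast_sum, Finset.mul_sum]

/-- The geometric sum for the Dirichlet kernel, cleared of denominators. -/
lemma sin_mul_sum_char2 (m : ℕ) (θ : ℝ) :
    (Real.sin θ : ℂ) * Complex.exp (θ * Complex.I) * ∑ a ∈ Finset.Ico 0 (m : ℤ), char2 a θ =
      Complex.exp (m * θ * Complex.I) * Real.sin (m * θ) := by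
  induction m with
  | zero => simp
  | succ m ih =>
    have : Finset.Ico 0 ((m + 1 : ℕ) : ℤ) = insert (m : ℤ) (Finset.Ico 0 (m : ℤ)) := by
      ext; simp only [Finset.mem_Ico, Finset.mem_insert]; push_cast; omega
    rw [this, Finset.sum_insert (by simp), mul_add, ih, char2]
    push_cast
    rw [Complex.sin, Complex.sin, Complex.sin]
    have e1 : Complex.exp (2 * m * θ * Complex.I) = Complex.exp (m * θ * Complex.I) ^ 2 := by
      rw [← Complex.exp_nat_mul]; push_cast; ring_nf
    have e2 : Complex.exp ((m + 1) * θ * Complex.I) =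
        Complex.exp (m * θ * Complex.I) * Complex.exp (θ * Complex.I) := by
      rw [← Complex.exp_add]; ring_nf
    simp only [neg_mul, Complex.exp_neg, e1, e2]
    have := Complex.exp_ne_zero (m * θ * Complex.I)
    have := Complex.exp_ne_zero (θ * Complex.I)
    field_simp
    ring

lemma char2_mul_sum_sq (m : ℕ) {θ : ℝ} (hθ : Real.sin θ ≠ 0) :
    char2 (-((m : ℤ) - 1)) θ * (∑ a ∈ Finset.Ico 0 (m : ℤ), char2 a θ) ^ 2 =
      (((Real.sin (m * θ) / Real.sin θ) ^ 2 : ℝ) : ℂ) := by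
  have h := sin_mul_sum_char2 m θ
  have hs : (Real.sin θ : ℂ) ≠ 0 := by exact_mod_cast hθ
  have he := Complex.exp_ne_zero (θ * Complex.I)
  have hS : ∑ a ∈ Finset.Ico 0 (m : ℤ), char2 a θ =
      Complex.exp (m * θ * Complex.I) * Real.sin (m * θ) /
        ((Real.sin θ : ℂ) * Complex.exp (θ * Complex.I)) := by
    rw [eq_div_iff (mul_ne_zero hs he), ← h]; ring
  have e1 : char2 (-((m : ℤ) - 1)) θ =
      Complex.exp (θ * Complex.I) ^ 2 / Complex.exp (m * θ * Complex.I) ^ 2 := by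
    rw [char2, ← Complex.exp_nat_mul, ← Complex.exp_nat_mul, ← Complex.exp_sub]
    push_cast; ring_nf
  rw [hS, e1]
  have := Complex.exp_ne_zero (m * θ * Complex.I)
  push_cast
  field_simp

/-- The largest representation count for the intervals `[0, m₁), [0, m₁), [0, m₂), [0, m₂), …` as
the integral of a product of Fejér kernels. -/
theorem integral_prod_fejer (l : List ℕ) :
    ∫ θ in (0 : ℝ)..Real.pi, (l.map fun m : ℕ => (Real.sin (m * θ) / Real.sin θ) ^ 2).prod =
      Real.pi * repCount ((duplicate l).map fun m : ℕ => Finset.Ico 0 (m : ℤ))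
        (l.map (fun m : ℕ => (m : ℤ) - 1)).sum := by
  have key : ∀ θ : ℝ, Real.sin θ ≠ 0 →
      char2 (-(l.map (fun m : ℕ => (m : ℤ) - 1)).sum) θ *
        (((duplicate l).map fun m : ℕ => Finset.Ico 0 (m : ℤ)).map
          fun A => ∑ a ∈ A, char2 a θ).prod =
      ((l.map fun m : ℕ => (Real.sin (m * θ) / Real.sin θ) ^ 2).prod : ℝ) := by
    intro θ hθ
    induction l with
    | nil => simp [duplicate, char2]
    | cons m l ih =>
      simp only [duplicate, List.map_cons, List.prod_cons, List.sum_cons, neg_add, char2_add]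
      rw [Complex.ofReal_mul, ← ih, ← char2_mul_sum_sq m hθ]
      ring
  have h := integral_char2_mul_prod ((duplicate l).map fun m : ℕ => Finset.Ico 0 (m : ℤ))
    (l.map (fun m : ℕ => (m : ℤ) - 1)).sum
  have h2 : ∫ θ in (0 : ℝ)..Real.pi, char2 (-(l.map (fun m : ℕ => (m : ℤ) - 1)).sum) θ *
        (((duplicate l).map fun m : ℕ => Finset.Ico 0 (m : ℤ)).map
          fun A => ∑ a ∈ A, char2 a θ).prod = ∫ θ in (0 : ℝ)..Real.pi,
      (((l.map fun m : ℕ => (Real.sin (m * θ) / Real.sin θ) ^ 2).prod : ℝ) : ℂ) := by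
    rw [intervalIntegral.integral_of_le Real.pi_pos.le, intervalIntegral.integral_of_le
      Real.pi_pos.le, integral_Ioc_eq_integral_Ioo, integral_Ioc_eq_integral_Ioo]
    exact setIntegral_congr_fun measurableSet_Ioo fun θ hθ =>
      key θ (Real.sin_pos_of_pos_of_lt_pi hθ.1 hθ.2).ne'
  rw [h2, intervalIntegral.integral_ofReal] at h
  exact_mod_cast h

/-! ### The integrals `∫₀¹ (1 - x²)^r` -/

/-- The Beta-type integral `∫₀¹ (1 - x²)^r dx`. -/
noncomputable def betaHalf (r : ℝ) : ℝ := ∫ x in (0 : ℝ)..1, (1 - x ^ 2) ^ r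

lemma continuous_one_sub_sq_rpow {r : ℝ} (hr : 0 ≤ r) : Continuous fun x : ℝ => (1 - x ^ 2) ^ r :=
  (by fun_prop : Continuous fun x : ℝ => 1 - x ^ 2).rpow_const fun _ => Or.inr hr

lemma betaHalf_pos {r : ℝ} (hr : 0 ≤ r) : 0 < betaHalf r := by
  refine intervalIntegral.intervalIntegral_pos_of_pos_on
    ((continuous_one_sub_sq_rpow hr).intervalIntegrable _ _) (fun x hx => ?_) zero_lt_one
  exact Real.rpow_pos_of_pos (by nlinarith [hx.1, hx.2]) _

lemma betaHalf_le {r s : ℝ} (hr : 0 ≤ r) (hrs : r ≤ s) : betaHalf s ≤ betaHalf r := by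
  refine intervalIntegral.integral_mono_on_of_le_Ioo zero_le_one
    ((continuous_one_sub_sq_rpow (hr.trans hrs)).intervalIntegrable _ _)
    ((continuous_one_sub_sq_rpow hr).intervalIntegrable _ _) fun x hx => ?_
  exact Real.rpow_le_rpow_of_exponent_ge (by nlinarith [hx.1, hx.2]) (by nlinarith [hx.1]) hrs

lemma betaHalf_add_one {r : ℝ} (hr : 0 ≤ r) :
    (2 * r + 3) * betaHalf (r + 1) = (2 * r + 2) * betaHalf r := by
  have hderiv : ∀ x ∈ Set.uIcc (0 : ℝ) 1, HasDerivAt (fun x : ℝ => x * (1 - x ^ 2) ^ (r + 1))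
      ((2 * r + 3) * (1 - x ^ 2) ^ (r + 1) - (2 * r + 2) * (1 - x ^ 2) ^ r) x := by
    intro x hx
    rw [Set.uIcc_of_le zero_le_one] at hx
    have h1 : HasDerivAt (fun x : ℝ => 1 - x ^ 2) (-(2 * x)) x := by
      simpa using (hasDerivAt_pow 2 x).const_sub 1
    have h2 := (hasDerivAt_id x).mul (h1.rpow_const (p := r + 1) (Or.inr (by linarith)))
    refine h2.congr_deriv ?_
    have h3 : (1 - x ^ 2) ^ (r + 1) = (1 - x ^ 2) * (1 - x ^ 2) ^ r := by
      rcases eq_or_ne (1 - x ^ 2) 0 with h | h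
      · rw [h, Real.zero_rpow (by linarith), zero_mul]
      · rw [Real.rpow_add_one h, mul_comm]
    simp only [add_sub_cancel_right, id, h3]
    ring
  have c1 := continuous_one_sub_sq_rpow (by linarith : 0 ≤ r + 1)
  have c0 := continuous_one_sub_sq_rpow hr
  have h := intervalIntegral.integral_eq_sub_of_hasDerivAt hderiv
    (((c1.const_mul _).sub (c0.const_mul _)).intervalIntegrable _ _)
  rw [intervalIntegral.integral_sub ((c1.const_mul _).intervalIntegrable _ _)
    ((c0.const_mul _).intervalIntegrable _ _), intervalIntegral.integral_const_mul,
    intervalIntegral.integral_const_mul] at h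
  have h0 : (1 : ℝ) * (1 - 1 ^ 2) ^ (r + 1) - 0 * (1 - 0 ^ 2) ^ (r + 1) = 0 := by
    rw [show (1 : ℝ) - 1 ^ 2 = 0 by norm_num, Real.zero_rpow (by linarith)]; ring
  rw [h0] at h
  exact sub_eq_zero.mp h

/-- The substitution `x = k sin θ`. -/
lemma integral_one_sub_sin_rpow {k b r : ℝ} (hr : 0 ≤ r) (hb : k * Real.sin b = 1) :
    ∫ θ in (0 : ℝ)..b, (1 - (k * Real.sin θ) ^ 2) ^ r * Real.cos θ = betaHalf r / k := by
  have hk : k ≠ 0 := by rintro rfl; simp at hb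
  have h := intervalIntegral.integral_comp_mul_deriv (a := 0) (b := b)
    (f := fun θ => k * Real.sin θ) (f' := fun θ => k * Real.cos θ)
    (g := fun x : ℝ => (1 - x ^ 2) ^ r) (fun θ _ => (Real.hasDerivAt_sin θ).const_mul k)
    (by fun_prop) (continuous_one_sub_sq_rpow hr)
  simp only [Function.comp, hb, Real.sin_zero, mul_zero] at h
  rw [betaHalf, ← h, eq_div_iff hk, ← intervalIntegral.integral_mul_const]
  congr 1
  funext θ
  ring

lemma integral_cos_rpow {q : ℝ} (hq : 1 ≤ q) :
    ∫ θ in (0 : ℝ)..(Real.pi / 2), (Real.cos θ ^ 2) ^ q = betaHalf (q - 1 / 2) := by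
  rw [← div_one (betaHalf _), ← integral_one_sub_sin_rpow (k := 1) (b := Real.pi / 2)
    (by linarith : 0 ≤ q - 1 / 2) (by simp)]
  refine intervalIntegral.integral_congr fun θ hθ => ?_
  rw [Set.uIcc_of_le (by positivity)] at hθ
  have hc : 0 ≤ Real.cos θ := Real.cos_nonneg_of_mem_Icc ⟨by linarith [hθ.1, Real.pi_pos], hθ.2⟩
  simp only [one_mul, ← Real.cos_sq']
  rw [← Real.rpow_natCast, ← Real.rpow_mul hc, ← Real.rpow_mul hc]
  nth_rewrite 3 [← Real.rpow_one (Real.cos θ)]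
  rw [← Real.rpow_add' hc (by push_cast; linarith)]
  congr 1
  push_cast
  ring

lemma betaHalf_half : betaHalf (1 / 2) = Real.pi / 4 := by
  have h := integral_cos_rpow le_rfl
  norm_num [integral_cos_sq] at h
  rw [← h]; ring

/-- The quantity `H(r) = B(r)² (3r + 5/2)`, with `B = betaHalf`, is nonincreasing for `r ≥ 1/2`:
the ratio `H(r + 1) / H(r)` is nondecreasing in `r`, so `H(s) / H(r) ≤ H(s + N) / H(r + N)` for
all `N`, and the upper limit of the right-hand side is at most `1`. -/
lemma betaHalf_sq_mul_le {r s : ℝ} (hr : 1 / 2 ≤ r) (hrs : r ≤ s) :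
    betaHalf s ^ 2 * (3 * s + 5 / 2) ≤ betaHalf r ^ 2 * (3 * r + 5 / 2) := by
  set H : ℝ → ℝ := fun t => betaHalf t ^ 2 * (3 * t + 5 / 2) with hH
  have Hpos : ∀ t, 1 / 2 ≤ t → 0 < H t := fun t ht =>
    mul_pos (pow_pos (betaHalf_pos (by linarith)) 2) (by linarith)
  -- `ρ t` is the ratio `H (t + 1) / H t`
  set ρ : ℝ → ℝ := fun t => 1 - (t + 1 / 2) / ((2 * t + 3) ^ 2 * (3 * t + 5 / 2)) with hρ
  have Hstep : ∀ t, 1 / 2 ≤ t → H (t + 1) = ρ t * H t := by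
    intro t ht
    have h := betaHalf_add_one (by linarith : 0 ≤ t)
    have h1 : betaHalf (t + 1) = (2 * t + 2) * betaHalf t / (2 * t + 3) := by
      rw [eq_div_iff (by linarith), ← h, mul_comm]
    simp only [hH, hρ, h1]
    have : 2 * t + 3 ≠ 0 := by linarith
    have : 3 * t + 5 / 2 ≠ 0 := by linarith
    field_simp
    ring
  have ρmono : ∀ t u, 1 / 2 ≤ t → t ≤ u → ρ t ≤ ρ u := by
    intro t u ht htu
    simp only [hρ]
    refine sub_le_sub_left ?_ 1
    have h1 : 0 < 2 * t + 3 := by linarith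
    have h2 : 0 < 3 * t + 5 / 2 := by linarith
    have h3 : 0 < 2 * u + 3 := by linarith
    have h4 : 0 < 3 * u + 5 / 2 := by linarith
    rw [div_le_div_iff₀ (by positivity) (by positivity)]
    obtain ⟨x, rfl⟩ : ∃ x, t = x - 1 / 2 := ⟨t + 1 / 2, by ring⟩
    obtain ⟨y, rfl⟩ : ∃ y, u = y - 1 / 2 := ⟨u + 1 / 2, by ring⟩
    have hx : 1 ≤ x := by linarith
    have hxy : x ≤ y := by linarith
    have hxy1 : 1 ≤ x * y := by nlinarith
    have : 0 ≤ (y - x) * (12 * (x * y) * (x + y) + 28 * (x * y) - 4) := by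
      refine mul_nonneg (by linarith) ?_
      nlinarith [mul_nonneg (by linarith : 0 ≤ x * y) (by linarith : 0 ≤ x + y)]
    nlinarith
  have hs : 1 / 2 ≤ s := hr.trans hrs
  have iter : ∀ N : ℕ, H s * H (r + N) ≤ H r * H (s + N) := by
    intro N
    induction N with
    | zero => simp [mul_comm]
    | succ N ih =>
      have hN : (0 : ℝ) ≤ N := N.cast_nonneg
      push_cast
      rw [← add_assoc, ← add_assoc, Hstep _ (by linarith), Hstep _ (by linarith)]
      have h1 := ρmono (r + N) (s + N) (by linarith) (by linarith)
      have h2 : 0 ≤ ρ (r + N) := by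
        have := Hstep (r + N) (by linarith)
        have h3 := Hpos (r + N + 1) (by linarith)
        rw [this] at h3
        exact (pos_of_mul_pos_left h3 (Hpos _ (by linarith)).le).le
      calc H s * (ρ (r + N) * H (r + N)) = ρ (r + N) * (H s * H (r + N)) := by ring
        _ ≤ ρ (r + N) * (H r * H (s + N)) := mul_le_mul_of_nonneg_left ih h2
        _ ≤ ρ (s + N) * (H r * H (s + N)) := mul_le_mul_of_nonneg_right h1
            (mul_pos (Hpos r hr) (Hpos _ (by linarith))).le
        _ = _ := by ring
  have bound : ∀ N : ℕ, H s ≤ H r * ((3 * (s + N) + 5 / 2) / (3 * (r + N) + 5 / 2)) := by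
    intro N
    have hN : (0 : ℝ) ≤ N := N.cast_nonneg
    have hd : 0 < 3 * (r + N) + 5 / 2 := by linarith
    have hB := betaHalf_pos (by linarith : 0 ≤ r + (N : ℝ))
    have h1 : H (s + N) ≤ betaHalf (r + N) ^ 2 * (3 * (s + N) + 5 / 2) := by
      refine mul_le_mul_of_nonneg_right ?_ (by linarith)
      exact pow_le_pow_left₀ (betaHalf_pos (by linarith)).le
        (betaHalf_le (by linarith) (by linarith)) 2
    have h2 := (iter N).trans (mul_le_mul_of_nonneg_left h1 (Hpos r hr).le)
    rw [← mul_div_assoc, le_div_iff₀ hd]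
    have h3 : H s * (3 * (r + N) + 5 / 2) * betaHalf (r + N) ^ 2 ≤
        H r * (3 * (s + N) + 5 / 2) * betaHalf (r + N) ^ 2 := by
      calc _ = H s * H (r + N) := by simp only [hH]; ring
        _ ≤ _ := h2
        _ = _ := by ring
    exact le_of_mul_le_mul_right h3 (pow_pos hB 2)
  have lim : Filter.Tendsto (fun N : ℕ => H r * ((3 * (s + N) + 5 / 2) / (3 * (r + N) + 5 / 2)))
      Filter.atTop (nhds (H r)) := by
    have h1 : ∀ N : ℕ, (3 * (s + N) + 5 / 2) / (3 * (r + N) + 5 / 2) =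
        1 + (3 * (s - r)) / (3 * (r + N) + 5 / 2) := by
      intro N
      have hN : (0 : ℝ) ≤ N := N.cast_nonneg
      have hd : 3 * (r + N) + 5 / 2 ≠ 0 := by linarith
      field_simp
      ring
    simp only [h1]
    have h2 : Filter.Tendsto (fun N : ℕ => 3 * (r + (N : ℝ)) + 5 / 2) Filter.atTop
        Filter.atTop :=
      Filter.tendsto_atTop_add_const_right _ _ ((Filter.tendsto_atTop_add_const_left _ _
        tendsto_natCast_atTop_atTop).const_mul_atTop (by norm_num))
    have h3 := (h2.const_div_atTop (3 * (s - r))).const_add 1 |>.const_mul (H r)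
    simpa using h3
  exact ge_of_tendsto' lim bound

lemma betaHalf_le_div_sqrt {r : ℝ} (hr : 1 / 2 ≤ r) :
    betaHalf r ≤ Real.pi / 2 / √(3 * r + 5 / 2) := by
  have h := betaHalf_sq_mul_le le_rfl hr
  rw [betaHalf_half] at h
  have hd : 0 < 3 * r + 5 / 2 := by linarith
  rw [le_div_iff₀ (Real.sqrt_pos.mpr hd)]
  refine le_of_sq_le_sq ?_ (by positivity)
  rw [mul_pow, Real.sq_sqrt hd.le]
  linarith

lemma betaHalf_le_mul_sqrt {r s : ℝ} (hr : 1 / 2 ≤ r) (hrs : r ≤ s) :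
    betaHalf s ≤ betaHalf r * √((3 * r + 5 / 2) / (3 * s + 5 / 2)) := by
  have h := betaHalf_sq_mul_le hr hrs
  have hd : 0 < 3 * r + 5 / 2 := by linarith
  have hd' : 0 < 3 * s + 5 / 2 := by linarith
  refine le_of_sq_le_sq ?_ (mul_nonneg (betaHalf_pos (by linarith)).le (Real.sqrt_nonneg _))
  rw [mul_pow, Real.sq_sqrt (by positivity), ← mul_div_assoc, le_div_iff₀ hd']
  exact h

/-! ### The Fejér kernel -/

/-- The normalised Fejér kernel `(sin (m θ) / (m sin θ))²`. At the zeros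
of `sin` it takes the junk value `0`, which does not affect integrals. -/
noncomputable def fejer (m : ℕ) (θ : ℝ) : ℝ := (Real.sin (m * θ) / (m * Real.sin θ)) ^ 2

lemma fejer_nonneg (m : ℕ) (θ : ℝ) : 0 ≤ fejer m θ := sq_nonneg _

lemma abs_sin_nat_mul_le (m : ℕ) (θ : ℝ) : |Real.sin (m * θ)| ≤ m * |Real.sin θ| := by
  induction m with
  | zero => simp
  | succ m ih =>
    push_cast
    rw [add_mul, one_mul, Real.sin_add]
    calc |Real.sin (m * θ) * Real.cos θ + Real.cos (m * θ) * Real.sin θ|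
        ≤ |Real.sin (m * θ)| * |Real.cos θ| + |Real.cos (m * θ)| * |Real.sin θ| := by
          rw [← abs_mul, ← abs_mul]; exact abs_add_le _ _
      _ ≤ |Real.sin (m * θ)| * 1 + 1 * |Real.sin θ| := by
          gcongr
          · exact Real.abs_cos_le_one _
          · exact Real.abs_cos_le_one _
      _ ≤ (m + 1) * |Real.sin θ| := by linarith

lemma fejer_le_one (m : ℕ) (θ : ℝ) : fejer m θ ≤ 1 := by
  rw [fejer, sq_le_one_iff_abs_le_one, abs_div, abs_mul, Nat.abs_cast]
  exact div_le_one_of_le₀ (abs_sin_nat_mul_le m θ) (by positivity)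

lemma measurable_fejer (m : ℕ) : Measurable (fejer m) := by
  unfold fejer
  fun_prop

lemma intervalIntegrable_fejer_rpow (m : ℕ) {q : ℝ} (hq : 0 ≤ q) (a b : ℝ) :
    IntervalIntegrable (fun θ => fejer m θ ^ q) volume a b := by
  refine (intervalIntegrable_const (c := (1 : ℝ))).mono_fun
    ((measurable_fejer m).pow_const q).aestronglyMeasurable (Filter.Eventually.of_forall fun θ => ?_)
  change ‖fejer m θ ^ q‖ ≤ ‖(1 : ℝ)‖
  rw [Real.norm_of_nonneg (Real.rpow_nonneg (fejer_nonneg m θ) q), norm_one]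
  exact Real.rpow_le_one (fejer_nonneg m θ) (fejer_le_one m θ) hq

lemma fejer_pi_sub (m : ℕ) (θ : ℝ) : fejer m (Real.pi - θ) = fejer m θ := by
  have h : Real.sin (m * (Real.pi - θ)) ^ 2 = Real.sin (m * θ) ^ 2 := by
    rw [mul_sub, Real.sin_sub, Real.sin_nat_mul_pi, zero_mul, zero_sub, neg_sq, mul_pow,
      Real.cos_sq', Real.sin_nat_mul_pi]
    ring
  rw [fejer, fejer, Real.sin_pi_sub, div_pow, div_pow, h]

lemma integral_fejer_rpow_eq (m : ℕ) {q : ℝ} (hq : 0 ≤ q) :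
    ∫ θ in (0 : ℝ)..Real.pi, fejer m θ ^ q =
      2 * ∫ θ in (0 : ℝ)..(Real.pi / 2), fejer m θ ^ q := by
  have hi := intervalIntegrable_fejer_rpow m hq
  rw [← intervalIntegral.integral_add_adjacent_intervals (hi 0 (Real.pi / 2))
    (hi (Real.pi / 2) Real.pi)]
  have h := intervalIntegral.integral_comp_sub_left (a := 0) (b := Real.pi / 2)
    (fun θ => fejer m θ ^ q) Real.pi
  simp only [fejer_pi_sub, sub_zero] at h
  rw [show Real.pi - Real.pi / 2 = Real.pi / 2 by ring] at h
  rw [← h]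
  ring

lemma repCount_pair (m : ℕ) :
    repCount [Finset.Ico 0 (m : ℤ), Finset.Ico 0 (m : ℤ)] ((m : ℤ) - 1) = m := by
  simp only [repCount]
  have h : ∀ a ∈ Finset.Ico 0 (m : ℤ), ∑ b ∈ Finset.Ico 0 (m : ℤ),
      (if (m : ℤ) - 1 - a - b = 0 then 1 else 0) = 1 := by
    intro a ha
    rw [Finset.mem_Ico] at ha
    rw [Finset.sum_eq_single ((m : ℤ) - 1 - a)]
    · simp
    · intro b _ hb
      rw [if_neg (by omega)]
    · intro hb
      exact absurd (Finset.mem_Ico.mpr ⟨by omega, by omega⟩) hb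
  rw [Finset.sum_congr rfl h]
  simp

lemma integral_fejer {m : ℕ} (hm : m ≠ 0) :
    ∫ θ in (0 : ℝ)..(Real.pi / 2), fejer m θ = Real.pi / (2 * m) := by
  have h := integral_prod_fejer [m]
  simp only [List.map_cons, List.map_nil, List.prod_cons, List.prod_nil, mul_one, List.sum_cons,
    List.sum_nil, add_zero, duplicate, repCount_pair] at h
  have h1 : ∀ θ, (Real.sin (m * θ) / Real.sin θ) ^ 2 = m ^ 2 * fejer m θ := by
    intro θ
    have : (m : ℝ) ≠ 0 := by exact_mod_cast hm
    rw [fejer, div_pow, div_pow, mul_pow, mul_div_assoc', mul_div_mul_left _ _ (by positivity)]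
  simp only [h1] at h
  have h2 := integral_fejer_rpow_eq m zero_le_one
  simp only [Real.rpow_one] at h2
  rw [intervalIntegral.integral_const_mul, h2] at h
  have : (m : ℝ) ≠ 0 := by exact_mod_cast hm
  rw [eq_div_iff (by positivity)]
  have h3 : (m : ℝ) * ((∫ θ in (0 : ℝ)..(Real.pi / 2), fejer m θ) * (2 * m)) = m * Real.pi := by
    rw [mul_comm (m : ℝ) Real.pi, ← h]; ring
  exact mul_left_cancel₀ this h3

/-- The discrete Ball inequality for `m = 2`, where the kernel is `cos² θ`. -/
theorem integral_fejer_two {q : ℝ} (hq : 1 ≤ q) :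
    ∫ θ in (0 : ℝ)..(Real.pi / 2), fejer 2 θ ^ q ≤ Real.pi / 2 / √(1 + q * 3) := by
  have h : ∫ θ in (0 : ℝ)..(Real.pi / 2), fejer 2 θ ^ q =
      ∫ θ in (0 : ℝ)..(Real.pi / 2), (Real.cos θ ^ 2) ^ q := by
    rw [intervalIntegral.integral_of_le (by positivity), intervalIntegral.integral_of_le
      (by positivity)]
    refine setIntegral_congr_fun measurableSet_Ioc fun θ hθ => ?_
    have hs : Real.sin θ ≠ 0 :=
      (Real.sin_pos_of_pos_of_lt_pi hθ.1 (by linarith [hθ.2, Real.pi_pos])).ne'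
    simp only [fejer]
    push_cast
    rw [Real.sin_two_mul, show 2 * Real.sin θ * Real.cos θ / (2 * Real.sin θ) = Real.cos θ by
      field_simp]
  rw [h, integral_cos_rpow hq]
  refine (betaHalf_le_div_sqrt (by linarith)).trans_eq ?_
  ring_nf

/-! ### The Fejér kernel for `m = 3` -/

lemma one_ninth_rpow_le {p : ℝ} (hp : 0 ≤ p) : (1 / 9 : ℝ) ^ p ≤ Real.exp (-(2 * p)) := by
  rw [show -(2 * p) = (-2) * p by ring, Real.exp_mul]
  refine Real.rpow_le_rpow (by norm_num) ?_ hp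
  have h : Real.exp 2 ≤ 9 := by
    have h1 := Real.exp_one_lt_d9
    have h2 : Real.exp 2 = Real.exp 1 * Real.exp 1 := by rw [← Real.exp_add]; norm_num
    nlinarith [Real.exp_pos 1]
  rw [Real.exp_neg, one_div]
  exact inv_anti₀ (Real.exp_pos 2) h

/-- The inequality in `p` that remains for `m = 3` after all integrals are evaluated. Both sides
equal `1` at `p = 0`. -/
lemma fejer_three_numeric {p : ℝ} (hp : 0 ≤ p) :
    √(54 / 59) / √(1 + 48 / 59 * p) + (1 / 9 : ℝ) ^ p * (1 - √(54 / 59) + 0.0304 * p) ≤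
      1 / √(1 + 8 / 9 * p) := by
  set M := √(54 / 59 : ℝ) with hM
  have hM2 : M ^ 2 = 54 / 59 := Real.sq_sqrt (by norm_num)
  have hM0 : 0 ≤ M := Real.sqrt_nonneg _
  have hMu : M ≤ 0.9568 := by nlinarith
  have hMl : 0.9566 ≤ M := by nlinarith
  set A := 1 + 48 / 59 * p with hA
  have hA1 : 0 < A := by positivity
  set T := √(1 + 8 / 9 * p) with hT
  have hT2 : T ^ 2 = 1 + 8 / 9 * p := Real.sq_sqrt (by positivity)
  have hT0 : 0 < T := Real.sqrt_pos.mpr (by positivity)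
  have hS0 : 0 < √A := Real.sqrt_pos.mpr hA1
  have hS2 : √A ^ 2 = A := Real.sq_sqrt hA1.le
  set y := M * T / √A with hy
  have hy0 : 0 ≤ y := by positivity
  have hy2 : (1 - y) * (1 + y) = 5 / 59 / A := by
    have : y ^ 2 = 54 / 59 * (1 + 8 / 9 * p) / A := by
      rw [hy, div_pow, mul_pow, hM2, hT2, hS2]
    rw [show (1 - y) * (1 + y) = 1 - y ^ 2 by ring, this]
    field_simp
    rw [hA]; ring
  have hyM : y ≤ M * (1 + 0.0377 * p) := by
    rw [hy, mul_div_assoc]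
    refine mul_le_mul_of_nonneg_left ?_ hM0
    rw [div_le_iff₀ hS0]
    refine le_of_sq_le_sq ?_ (by positivity)
    rw [mul_pow, hT2, hS2, hA]
    nlinarith [mul_nonneg hp hp, mul_nonneg (mul_nonneg hp hp) hp]
  have hy1 : 1 + y ≤ (1 + M) * (1 + 0.0185 * p) := by nlinarith
  have hM1 : (1 - M) * (1 + M) = 5 / 59 := by linarith [hM2, sq M]
  have hlow : 1 - M ≤ (1 - y) * (A * (1 + 0.0185 * p)) := by
    have h1 : (1 - M) * (1 + M) = (1 - y) * (1 + y) * A := by rw [hM1, hy2]; field_simp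
    have hpos : 0 ≤ 1 - y := by
      by_contra h
      have : (1 - y) * (1 + y) < 0 := mul_neg_of_neg_of_pos (by linarith) (by linarith)
      have h5 : 0 < 5 / 59 / A := by positivity
      linarith
    have h2 : (1 - y) * (1 + y) * A ≤ (1 - y) * ((1 + M) * (1 + 0.0185 * p)) * A :=
      mul_le_mul_of_nonneg_right (mul_le_mul_of_nonneg_left hy1 hpos) hA1.le
    have h3 : (1 - M) * (1 + M) ≤ (1 - y) * (A * (1 + 0.0185 * p)) * (1 + M) := by
      rw [h1]; refine h2.trans_eq (by ring)
    exact le_of_mul_le_mul_right h3 (by linarith)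
  -- all the factors are absorbed by `9 ^ (-p) ≤ exp (-2 p)`
  have hE : (1 / 9 : ℝ) ^ p * ((1 + 0.71 * p) * (1 + 0.0185 * p) * A * T) ≤ 1 := by
    have e1 : 1 + 0.71 * p ≤ Real.exp (0.71 * p) := by linarith [Real.add_one_le_exp (0.71 * p)]
    have e2 : 1 + 0.0185 * p ≤ Real.exp (0.0185 * p) := by
      linarith [Real.add_one_le_exp (0.0185 * p)]
    have e3 : A ≤ Real.exp (48 / 59 * p) := by linarith [Real.add_one_le_exp (48 / 59 * p)]
    have e4 : T ≤ Real.exp (4 / 9 * p) := by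
      refine le_of_sq_le_sq ?_ (Real.exp_pos _).le
      rw [hT2, ← Real.exp_nat_mul]
      push_cast
      rw [show 2 * (4 / 9 * p) = 8 / 9 * p by ring]
      linarith [Real.add_one_le_exp (8 / 9 * p)]
    calc (1 / 9 : ℝ) ^ p * ((1 + 0.71 * p) * (1 + 0.0185 * p) * A * T)
        ≤ Real.exp (-(2 * p)) * (Real.exp (0.71 * p) * Real.exp (0.0185 * p) *
            Real.exp (48 / 59 * p) * Real.exp (4 / 9 * p)) := by
          gcongr
          exact one_ninth_rpow_le hp
      _ = Real.exp (-(2 * p) + (0.71 * p + 0.0185 * p + 48 / 59 * p + 4 / 9 * p)) := by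
          simp only [← Real.exp_add]
      _ ≤ 1 := Real.exp_le_one_iff.mpr (by linarith)
  have hE0 : 0 ≤ (1 / 9 : ℝ) ^ p := by positivity
  have hlast : (1 / 9 : ℝ) ^ p * (1 - M + 0.0304 * p) * T ≤ 1 - y := by
    have hB : 0 < A * (1 + 0.0185 * p) := by positivity
    refine le_of_mul_le_mul_right ?_ hB
    refine le_trans ?_ hlow
    have h1 : 1 - M + 0.0304 * p ≤ (1 - M) * (1 + 0.71 * p) := by nlinarith
    calc (1 / 9 : ℝ) ^ p * (1 - M + 0.0304 * p) * T * (A * (1 + 0.0185 * p))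
        ≤ (1 / 9 : ℝ) ^ p * ((1 - M) * (1 + 0.71 * p)) * T * (A * (1 + 0.0185 * p)) := by gcongr
      _ = (1 - M) * ((1 / 9 : ℝ) ^ p * ((1 + 0.71 * p) * (1 + 0.0185 * p) * A * T)) := by ring
      _ ≤ (1 - M) * 1 := mul_le_mul_of_nonneg_left hE (by linarith)
      _ = 1 - M := mul_one _
  rw [le_div_iff₀ hT0, add_mul]
  have : M / √A * T = y := by rw [hy]; ring
  linarith

lemma fejer_three_eq {θ : ℝ} (h0 : 0 < θ) (h1 : θ < Real.pi) :
    fejer 3 θ = (1 - (2 / √3 * Real.sin θ) ^ 2) ^ 2 := by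
  have hs := (Real.sin_pos_of_pos_of_lt_pi h0 h1).ne'
  have h3 : √3 ^ 2 = (3 : ℝ) := Real.sq_sqrt (by norm_num)
  rw [fejer]
  push_cast
  rw [Real.sin_three_mul]
  congr 1
  rw [mul_pow, div_pow, h3]
  field_simp
  ring

/-- Bound for the error on the part of the main lobe where the kernel `w²` is below the height
`1/9` of the side lobe. -/
lemma rpow_mul_one_sub_rpow_le {w p : ℝ} (hp : 0 ≤ p) (hw : 0 ≤ w) (hw3 : w ≤ 1 / 3) :
    w ^ (13 / 8 : ℝ) * ((1 / 9 : ℝ) ^ p - (w ^ 2) ^ p) ≤ (1 / 9 : ℝ) ^ p * p / 10 := by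
  rcases hw.eq_or_lt with rfl | hw
  · rw [Real.zero_rpow (by norm_num), zero_mul]; positivity
  have h1 : (w ^ 2) ^ p = (1 / 9 : ℝ) ^ p * (9 * w ^ 2) ^ p := by
    rw [← Real.mul_rpow (by norm_num) (by positivity)]; ring_nf
  have h2 : 1 - (9 * w ^ 2) ^ p ≤ -(Real.log (9 * w ^ 2) * p) := by
    rw [Real.rpow_def_of_pos (by positivity)]
    linarith [Real.add_one_le_exp (Real.log (9 * w ^ 2) * p)]
  have h3 : w ^ (13 / 8 : ℝ) ≤ w ^ (3 / 2 : ℝ) :=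
    Real.rpow_le_rpow_of_exponent_ge hw (by linarith) (by norm_num)
  -- `log X ≤ X / e` for `X = (3 w) ^ (-3/2)`
  have hX : 0 < (3 * w) ^ (-(3 / 2) : ℝ) := Real.rpow_pos_of_pos (by positivity) _
  have h4 : Real.log ((3 * w) ^ (-(3 / 2) : ℝ)) ≤ (3 * w) ^ (-(3 / 2) : ℝ) / Real.exp 1 := by
    have := Real.log_le_sub_one_of_pos (div_pos hX (Real.exp_pos 1))
    rw [Real.log_div hX.ne' (Real.exp_pos 1).ne', Real.log_exp] at this
    linarith
  rw [Real.log_rpow (by positivity)] at h4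
  have h5 : Real.log (9 * w ^ 2) = 2 * Real.log (3 * w) := by
    rw [show 9 * w ^ 2 = (3 * w) ^ 2 by ring, Real.log_pow]; norm_num
  have h6 : w ^ (3 / 2 : ℝ) * (3 * w) ^ (-(3 / 2) : ℝ) = (3 : ℝ) ^ (-(3 / 2) : ℝ) := by
    rw [Real.mul_rpow (by norm_num) hw.le, mul_comm, mul_assoc, ← Real.rpow_add hw]
    norm_num
  have h7 : (3 : ℝ) ^ (-(3 / 2) : ℝ) ≤ 0.1925 := by
    rw [show (-(3 / 2) : ℝ) = -1 + -(1 / 2) by norm_num, Real.rpow_add (by norm_num),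
      Real.rpow_neg_one, Real.rpow_neg (by norm_num), ← Real.sqrt_eq_rpow]
    have : (1.732 : ℝ) ≤ √3 := Real.le_sqrt_of_sq_le (by norm_num)
    calc (3 : ℝ)⁻¹ * (√3)⁻¹ ≤ 3⁻¹ * (1.732)⁻¹ := by gcongr
      _ ≤ _ := by norm_num
  have he := Real.exp_one_gt_d9
  have h8 : -(Real.log (9 * w ^ 2)) ≤ 4 / 3 * ((3 * w) ^ (-(3 / 2) : ℝ) / Real.exp 1) := by
    rw [h5]; linarith
  have hE : 0 ≤ (1 / 9 : ℝ) ^ p := by positivity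
  have hlog : 0 ≤ -(Real.log (9 * w ^ 2)) := by
    rw [neg_nonneg]; exact Real.log_nonpos (by positivity) (by nlinarith)
  have h9 : w ^ (13 / 8 : ℝ) * -(Real.log (9 * w ^ 2)) ≤ 1 / 10 := by
    calc w ^ (13 / 8 : ℝ) * -(Real.log (9 * w ^ 2))
        ≤ w ^ (3 / 2 : ℝ) * (4 / 3 * ((3 * w) ^ (-(3 / 2) : ℝ) / Real.exp 1)) := by gcongr
      _ = 4 / 3 * (w ^ (3 / 2 : ℝ) * (3 * w) ^ (-(3 / 2) : ℝ)) / Real.exp 1 := by ring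
      _ ≤ 4 / 3 * 0.1925 / 2.7 := by rw [h6]; gcongr; linarith
      _ ≤ 1 / 10 := by norm_num
  rw [h1]
  calc w ^ (13 / 8 : ℝ) * ((1 / 9 : ℝ) ^ p - (1 / 9 : ℝ) ^ p * (9 * w ^ 2) ^ p)
      = (1 / 9 : ℝ) ^ p * (w ^ (13 / 8 : ℝ) * (1 - (9 * w ^ 2) ^ p)) := by ring
    _ ≤ (1 / 9 : ℝ) ^ p * (w ^ (13 / 8 : ℝ) * -(Real.log (9 * w ^ 2) * p)) := by gcongr
    _ = (1 / 9 : ℝ) ^ p * (w ^ (13 / 8 : ℝ) * -(Real.log (9 * w ^ 2)) * p) := by ring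
    _ ≤ (1 / 9 : ℝ) ^ p * (1 / 10 * p) := by gcongr
    _ = _ := by ring

/-- The discrete Ball inequality for `m = 3`. With `x = (2 / √3) sin θ` and `w = 1 - x²` the kernel is
`w²`; its main lobe is `θ ≤ π/3`, and `w = 1/3` at `θ = π/4`. The side lobe has height `1/9`. -/
theorem integral_fejer_three {q : ℝ} (hq : 1 ≤ q) :
    ∫ θ in (0 : ℝ)..(Real.pi / 2), fejer 3 θ ^ q ≤ Real.pi / 2 / √(1 + q * 8) := by
  obtain ⟨p, rfl⟩ : ∃ p, q = 1 + p := ⟨q - 1, by ring⟩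
  have hp : 0 ≤ p := by linarith
  have hpi := Real.pi_pos
  set E : ℝ := (1 / 9 : ℝ) ^ p with hE
  have hE0 : 0 ≤ E := by positivity
  set w : ℝ → ℝ := fun θ => 1 - (2 / √3 * Real.sin θ) ^ 2 with hw
  have h3 : √3 ^ 2 = (3 : ℝ) := Real.sq_sqrt (by norm_num)
  have hws : ∀ θ, w θ = 1 - 4 / 3 * Real.sin θ ^ 2 := fun θ => by
    simp only [hw, mul_pow, div_pow, h3]; norm_num
  have hwc : Continuous w := by fun_prop
  have hf : ∀ θ, 0 < θ → θ ≤ Real.pi / 2 → fejer 3 θ = w θ ^ 2 := fun θ h0 h1 =>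
    fejer_three_eq h0 (by linarith)
  have hf1 : ∀ θ, fejer 3 θ ^ (1 + p) = fejer 3 θ * fejer 3 θ ^ p := fun θ => by
    rw [Real.rpow_add' (fejer_nonneg 3 θ) (by linarith), Real.rpow_one]
  -- the majorant of `fejer 3 θ * (fejer 3 θ ^ p - E)` on the main lobe
  set G : ℝ → ℝ := fun θ =>
    w θ ^ (13 / 8 + 2 * p) * Real.cos θ - E * (w θ ^ (13 / 8 : ℝ) * Real.cos θ) with hG
  have hsplit : ∀ θ, 0 ≤ w θ →
      G θ = w θ ^ (13 / 8 : ℝ) * Real.cos θ * ((w θ ^ 2) ^ p - E) := by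
    intro θ h
    simp only [hG]
    rw [Real.rpow_add' h (by linarith), Real.rpow_mul h]
    norm_cast
    ring
  have hdens : ∀ θ, 0 < θ → θ ≤ Real.pi / 3 →
      0 ≤ w θ ∧ 0 ≤ Real.cos θ ∧ fejer 3 θ ≤ w θ ^ (13 / 8 : ℝ) * Real.cos θ := by
    intro θ h0 h1
    have hc : 0 ≤ Real.cos θ := Real.cos_nonneg_of_mem_Icc ⟨by linarith, by linarith⟩
    have hc2 : 1 / 2 ≤ Real.cos θ := by
      rw [← Real.cos_pi_div_three]
      exact Real.cos_le_cos_of_nonneg_of_le_pi h0.le (by linarith) h1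
    have hcs := Real.sin_sq_add_cos_sq θ
    have hwθ := hws θ
    have hw0 : 0 ≤ w θ := by nlinarith
    refine ⟨hw0, hc, ?_⟩
    have hb : w θ ^ (3 / 8 : ℝ) ≤ Real.cos θ := by
      -- Bernoulli: `(1 - x²) ^ (3/4) ≤ 1 - 3/4 x² = cos² θ`
      have hB : w θ ^ (3 / 4 : ℝ) ≤ 1 + 3 / 4 * (w θ - 1) := by
        have := rpow_one_add_le_one_add_mul_self (s := w θ - 1) (by linarith)
          (p := 3 / 4) (by norm_num) (by norm_num)
        simpa using this
      refine le_of_sq_le_sq ?_ hc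
      rw [← Real.rpow_natCast, ← Real.rpow_mul hw0]
      norm_num
      refine hB.trans ?_
      rw [hwθ]; linarith
    rw [hf θ h0 (by linarith)]
    calc w θ ^ 2 = w θ ^ (13 / 8 : ℝ) * w θ ^ (3 / 8 : ℝ) := by
          rw [← Real.rpow_add' hw0 (by norm_num)]; norm_num
      _ ≤ _ := mul_le_mul_of_nonneg_left hb (Real.rpow_nonneg hw0 _)
  have hi : ∀ a b, IntervalIntegrable (fun θ => fejer 3 θ ^ (1 + p)) volume a b :=
    intervalIntegrable_fejer_rpow 3 (by linarith)
  have hi1 : ∀ a b, IntervalIntegrable (fun θ => fejer 3 θ) volume a b := fun a b => by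
    simpa using intervalIntegrable_fejer_rpow 3 zero_le_one a b
  have hcG1 : Continuous fun θ => w θ ^ (13 / 8 + 2 * p) * Real.cos θ :=
    (hwc.rpow_const fun _ => Or.inr (by linarith)).mul Real.continuous_cos
  have hcG2 : Continuous fun θ => w θ ^ (13 / 8 : ℝ) * Real.cos θ :=
    (hwc.rpow_const fun _ => Or.inr (by norm_num)).mul Real.continuous_cos
  have hcG : Continuous G := hcG1.sub (hcG2.const_mul E)
  have b1 : ∫ θ in (0 : ℝ)..(Real.pi / 4), fejer 3 θ ^ (1 + p) ≤
      ∫ θ in (0 : ℝ)..(Real.pi / 4), (E * fejer 3 θ + G θ) := by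
    refine intervalIntegral.integral_mono_on_of_le_Ioo (by linarith) (hi _ _)
      (((hi1 _ _).const_mul E).add (hcG.intervalIntegrable _ _)) fun θ hθ => ?_
    obtain ⟨hw0, hc, hd⟩ := hdens θ hθ.1 (by linarith [hθ.2])
    have hw3 : 1 / 3 ≤ w θ := by
      have h1 : Real.sin θ ≤ √2 / 2 := by
        rw [← Real.sin_pi_div_four]
        exact Real.sin_le_sin_of_le_of_le_pi_div_two (by linarith [hθ.1]) (by linarith) hθ.2.le
      have h0 : 0 ≤ Real.sin θ := Real.sin_nonneg_of_nonneg_of_le_pi hθ.1.le (by linarith [hθ.2])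
      have h2 : Real.sin θ ^ 2 ≤ (√2 / 2) ^ 2 := pow_le_pow_left₀ h0 h1 2
      rw [div_pow, Real.sq_sqrt (by norm_num)] at h2
      rw [hws]; linarith
    have hEF : E ≤ (w θ ^ 2) ^ p := Real.rpow_le_rpow (by norm_num) (by nlinarith) hp
    rw [hsplit θ hw0, hf1]
    have := mul_le_mul_of_nonneg_right hd (sub_nonneg.mpr hEF)
    rw [hf θ hθ.1 (by linarith [hθ.2])] at this ⊢
    linarith
  have b2 : ∫ θ in (Real.pi / 4)..(Real.pi / 3), fejer 3 θ ^ (1 + p) ≤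
      ∫ θ in (Real.pi / 4)..(Real.pi / 3), (E * fejer 3 θ + G θ + E * p / 10 * Real.cos θ) := by
    refine intervalIntegral.integral_mono_on_of_le_Ioo (by linarith) (hi _ _)
      ((((hi1 _ _).const_mul E).add (hcG.intervalIntegrable _ _)).add
        ((Real.continuous_cos.const_mul _).intervalIntegrable _ _)) fun θ hθ => ?_
    have hθ0 : 0 < θ := by linarith [hθ.1]
    obtain ⟨hw0, hc, hd⟩ := hdens θ hθ0 hθ.2.le
    have hw3 : w θ ≤ 1 / 3 := by
      have h1 : √2 / 2 ≤ Real.sin θ := by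
        rw [← Real.sin_pi_div_four]
        exact Real.sin_le_sin_of_le_of_le_pi_div_two (by linarith) (by linarith [hθ.2]) hθ.1.le
      have h2 : (√2 / 2) ^ 2 ≤ Real.sin θ ^ 2 := pow_le_pow_left₀ (by positivity) h1 2
      rw [div_pow, Real.sq_sqrt (by norm_num)] at h2
      rw [hws]; linarith
    have hEF : (w θ ^ 2) ^ p ≤ E := Real.rpow_le_rpow (by positivity) (by nlinarith) hp
    rw [hsplit θ hw0, hf1]
    have h1 := mul_le_mul_of_nonneg_right (rpow_mul_one_sub_rpow_le hp hw0 hw3) hc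
    have h2 := mul_le_mul_of_nonneg_left hEF (fejer_nonneg 3 θ)
    rw [hf θ hθ0 (by linarith [hθ.2])] at h2 ⊢
    linarith
  have b3 : ∫ θ in (Real.pi / 3)..(Real.pi / 2), fejer 3 θ ^ (1 + p) ≤
      ∫ θ in (Real.pi / 3)..(Real.pi / 2), E * fejer 3 θ := by
    refine intervalIntegral.integral_mono_on_of_le_Ioo (by linarith) (hi _ _)
      ((hi1 _ _).const_mul E) fun θ hθ => ?_
    have hθ0 : 0 < θ := by linarith [hθ.1]
    rw [hf1, mul_comm]
    refine mul_le_mul_of_nonneg_right (Real.rpow_le_rpow (fejer_nonneg 3 θ) ?_ hp)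
      (fejer_nonneg 3 θ)
    have h1 : √3 / 2 ≤ Real.sin θ := by
      rw [← Real.sin_pi_div_three]
      exact Real.sin_le_sin_of_le_of_le_pi_div_two (by linarith) hθ.2.le hθ.1.le
    have h2 : (√3 / 2) ^ 2 ≤ Real.sin θ ^ 2 := pow_le_pow_left₀ (by positivity) h1 2
    rw [div_pow, h3] at h2
    have h4 := Real.sin_sq_le_one θ
    rw [hf θ hθ0 hθ.2.le, hws]
    nlinarith
  have hG' := hcG.intervalIntegrable (μ := volume)
  have hEf := fun a b => (hi1 a b).const_mul E
  have htotal : ∫ θ in (0 : ℝ)..(Real.pi / 2), fejer 3 θ ^ (1 + p) ≤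
      E * (Real.pi / 6) + (√3 / 2 * betaHalf (13 / 8 + 2 * p) - E * (√3 / 2 * betaHalf (13 / 8)))
        + E * p / 10 * (√3 / 2 - √2 / 2) := by
    have s1 : ∫ θ in (0 : ℝ)..(Real.pi / 3), G θ =
        √3 / 2 * betaHalf (13 / 8 + 2 * p) - E * (√3 / 2 * betaHalf (13 / 8)) := by
      have hsin : 2 / √3 * Real.sin (Real.pi / 3) = 1 := by
        rw [Real.sin_pi_div_three]; field_simp
      simp only [hG]
      rw [intervalIntegral.integral_sub (hcG1.intervalIntegrable _ _)
        ((hcG2.const_mul E).intervalIntegrable _ _), intervalIntegral.integral_const_mul,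
        integral_one_sub_sin_rpow (by linarith) hsin, integral_one_sub_sin_rpow (by norm_num) hsin]
      field_simp
    have s2 : ∫ θ in (0 : ℝ)..(Real.pi / 2), E * fejer 3 θ = E * (Real.pi / 6) := by
      rw [intervalIntegral.integral_const_mul, integral_fejer (by norm_num)]
      push_cast; ring
    rw [intervalIntegral.integral_add (hEf _ _) (hG' _ _)] at b1
    rw [intervalIntegral.integral_add ((hEf _ _).add (hG' _ _))
      ((Real.continuous_cos.const_mul _).intervalIntegrable _ _),
      intervalIntegral.integral_add (hEf _ _) (hG' _ _), intervalIntegral.integral_const_mul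
      (E * p / 10), integral_cos, Real.sin_pi_div_three, Real.sin_pi_div_four] at b2
    rw [← s1, ← s2, ← intervalIntegral.integral_add_adjacent_intervals (hi 0 (Real.pi / 3)) (hi _ _),
      ← intervalIntegral.integral_add_adjacent_intervals (hi 0 (Real.pi / 4)) (hi _ _),
      ← intervalIntegral.integral_add_adjacent_intervals (hEf 0 (Real.pi / 3)) (hEf _ _),
      ← intervalIntegral.integral_add_adjacent_intervals (hEf 0 (Real.pi / 4)) (hEf _ _),
      ← intervalIntegral.integral_add_adjacent_intervals (hG' 0 (Real.pi / 4)) (hG' _ _)]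
    linarith
  refine htotal.trans ?_
  -- bound `betaHalf` by means of its monotonicity property
  have hB0 := betaHalf_pos (show (0 : ℝ) ≤ 13 / 8 by norm_num)
  have hBle : betaHalf (13 / 8) ≤ Real.pi / 2 / √(59 / 8) := by
    have := betaHalf_le_div_sqrt (r := 13 / 8) (by norm_num)
    norm_num at this ⊢
    exact this
  have hA1 : 0 < 1 + 48 / 59 * p := by positivity
  have hBp : betaHalf (13 / 8 + 2 * p) ≤ betaHalf (13 / 8) / √(1 + 48 / 59 * p) := by
    have := betaHalf_le_mul_sqrt (r := 13 / 8) (s := 13 / 8 + 2 * p) (by norm_num) (by linarith)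
    refine this.trans_eq ?_
    rw [div_eq_mul_inv (betaHalf _), ← Real.sqrt_inv]
    congr 2
    have : 3 * (13 / 8 + 2 * p) + 5 / 2 ≠ 0 := by positivity
    field_simp
    ring
  have hEs : E ≤ 1 / √(1 + 48 / 59 * p) := by
    have h1 : E ≤ Real.exp (-(2 * p)) := one_ninth_rpow_le hp
    refine h1.trans ?_
    rw [Real.exp_neg, ← one_div]
    refine one_div_le_one_div_of_le (Real.sqrt_pos.mpr hA1) ?_
    rw [Real.sqrt_le_left (Real.exp_pos _).le, ← Real.exp_nat_mul]
    push_cast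
    linarith [Real.add_one_le_exp (2 * (2 * p))]
  have hM : √3 / 2 * (Real.pi / 2 / √(59 / 8)) = Real.pi / 6 * √(54 / 59) := by
    have : √3 / √(59 / 8) = 2 / 3 * √(54 / 59) := by
      rw [← Real.sqrt_div (by norm_num), show (2 / 3 : ℝ) = √(4 / 9) by
        rw [show (4 / 9 : ℝ) = (2 / 3) ^ 2 by norm_num, Real.sqrt_sq (by norm_num)],
        ← Real.sqrt_mul (by norm_num)]
      norm_num
    calc _ = Real.pi / 4 * (√3 / √(59 / 8)) := by ring
      _ = _ := by rw [this]; ring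
  have hnum := fejer_three_numeric hp
  rw [← hE] at hnum
  have hroot : √(1 + (1 + p) * 8) = 3 * √(1 + 8 / 9 * p) := by
    rw [show 1 + (1 + p) * 8 = 3 ^ 2 * (1 + 8 / 9 * p) by ring, Real.sqrt_mul (by norm_num),
      Real.sqrt_sq (by norm_num)]
  have hτ : √3 / 2 - √2 / 2 ≤ 10 * 0.0304 * (Real.pi / 6) := by
    have h31 : √3 ≤ 1.7321 := (Real.sqrt_le_left (by norm_num)).mpr (by norm_num)
    have h21 : 1.4142 ≤ √2 := Real.le_sqrt_of_sq_le (by norm_num)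
    linarith [Real.pi_gt_d2]
  calc E * (Real.pi / 6) + (√3 / 2 * betaHalf (13 / 8 + 2 * p) - E * (√3 / 2 * betaHalf (13 / 8)))
        + E * p / 10 * (√3 / 2 - √2 / 2)
      ≤ E * (Real.pi / 6) + (√3 / 2 * (betaHalf (13 / 8) / √(1 + 48 / 59 * p)) -
        E * (√3 / 2 * betaHalf (13 / 8))) + E * p / 10 * (10 * 0.0304 * (Real.pi / 6)) := by
        gcongr
    _ = E * (Real.pi / 6) + √3 / 2 * betaHalf (13 / 8) * (1 / √(1 + 48 / 59 * p) - E)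
        + Real.pi / 6 * (E * (0.0304 * p)) := by ring
    _ ≤ E * (Real.pi / 6) + √3 / 2 * (Real.pi / 2 / √(59 / 8)) * (1 / √(1 + 48 / 59 * p) - E)
        + Real.pi / 6 * (E * (0.0304 * p)) := by
        have := sub_nonneg.mpr hEs
        gcongr
    _ = Real.pi / 6 * (√(54 / 59) / √(1 + 48 / 59 * p) + E * (1 - √(54 / 59) + 0.0304 * p)) := by
        rw [hM]; ring
    _ ≤ Real.pi / 6 * (1 / √(1 + 8 / 9 * p)) := mul_le_mul_of_nonneg_left hnum (by positivity)
    _ = Real.pi / 2 / √(1 + (1 + p) * 8) := by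
        rw [hroot]
        have : 0 < √(1 + 8 / 9 * p) := Real.sqrt_pos.mpr (by positivity)
        field_simp
        ring

/-! ### The Fejér kernels for `m ≥ 4` -/

lemma mul_cos_le_sin {t : ℝ} (h0 : 0 ≤ t) (h1 : t ≤ Real.pi) : t * Real.cos t ≤ Real.sin t := by
  have hmono : MonotoneOn (fun t : ℝ => Real.sin t - t * Real.cos t) (Set.Icc 0 Real.pi) := by
    refine monotoneOn_of_hasDerivWithinAt_nonneg (f' := fun t => t * Real.sin t)
      (convex_Icc _ _) (by fun_prop) (fun x hx => ?_) (fun x hx => ?_)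
    · refine ((Real.hasDerivAt_sin x).sub
        ((hasDerivAt_id x).mul (Real.hasDerivAt_cos x))).hasDerivWithinAt.congr_deriv ?_
      simp
    · rw [interior_Icc] at hx
      exact mul_nonneg hx.1.le (Real.sin_nonneg_of_nonneg_of_le_pi hx.1.le hx.2.le)
  have := hmono ⟨le_rfl, Real.pi_pos.le⟩ ⟨h0, h1⟩ h0
  simp only [Real.sin_zero, zero_mul, sub_zero] at this
  linarith

/-- Equivalent to `cot t ≤ 1/t - t/3`. -/
lemma mul_cos_add_le_sin {t : ℝ} (h0 : 0 ≤ t) (h1 : t ≤ Real.pi) :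
    t * Real.cos t + t ^ 2 / 3 * Real.sin t ≤ Real.sin t := by
  have hmono : MonotoneOn (fun t : ℝ => Real.sin t - t * Real.cos t - t ^ 2 / 3 * Real.sin t)
      (Set.Icc 0 Real.pi) := by
    refine monotoneOn_of_hasDerivWithinAt_nonneg
      (f' := fun t => t / 3 * (Real.sin t - t * Real.cos t))
      (convex_Icc _ _) (by fun_prop) (fun x hx => ?_) (fun x hx => ?_)
    · refine (((Real.hasDerivAt_sin x).sub ((hasDerivAt_id x).mul (Real.hasDerivAt_cos x))).sub
        (((hasDerivAt_pow 2 x).div_const 3).mul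
          (Real.hasDerivAt_sin x))).hasDerivWithinAt.congr_deriv ?_
      simp
      ring
    · rw [interior_Icc] at hx
      have := mul_cos_le_sin hx.1.le hx.2.le
      exact mul_nonneg (by linarith [hx.1]) (by linarith)
  have := hmono ⟨le_rfl, Real.pi_pos.le⟩ ⟨h0, h1⟩ h0
  simp only [Real.sin_zero, zero_mul, sub_zero, mul_zero] at this
  linarith

/-- `t ↦ (sin t / t) exp (t² / 6)` is decreasing on `(0, π]`. -/
lemma sin_div_mul_exp_antitone : AntitoneOn (fun t : ℝ => Real.sin t / t * Real.exp (t ^ 2 / 6))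
    (Set.Ioc 0 Real.pi) := by
  have hd : ∀ x : ℝ, 0 < x → HasDerivAt (fun t : ℝ => Real.sin t / t * Real.exp (t ^ 2 / 6))
      ((x * Real.cos x + x ^ 2 / 3 * Real.sin x - Real.sin x) * (Real.exp (x ^ 2 / 6) / x ^ 2))
      x := by
    intro x hx
    have h1 : HasDerivAt (fun t : ℝ => Real.exp (t ^ 2 / 6))
        (Real.exp (x ^ 2 / 6) * (2 * x / 6)) x := by
      simpa using ((hasDerivAt_pow 2 x).div_const 6).exp
    refine (((Real.hasDerivAt_sin x).div (hasDerivAt_id x) hx.ne').mul h1).congr_deriv ?_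
    simp only [Pi.div_apply, id]
    field_simp
    ring
  refine antitoneOn_of_hasDerivWithinAt_nonpos (convex_Ioc _ _)
    (fun x hx => (hd x hx.1).continuousAt.continuousWithinAt)
    (fun x hx => (hd x ?_).hasDerivWithinAt) (fun x hx => ?_)
  · rw [interior_Ioc] at hx; exact hx.1
  · rw [interior_Ioc] at hx
    have := mul_cos_add_le_sin hx.1.le hx.2.le
    exact mul_nonpos_of_nonpos_of_nonneg (by linarith) (by positivity)

lemma cos_le_exp {t : ℝ} (h0 : 0 ≤ t) (h1 : t ≤ Real.pi / 2) :
    Real.cos t ≤ Real.exp (-(t ^ 2 / 2 + t ^ 4 / 12)) := by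
  have hpi := Real.pi_pos
  have hL : MonotoneOn (fun t : ℝ => Real.sin t - (t + t ^ 3 / 3) * Real.cos t)
      (Set.Icc 0 (Real.pi / 2)) := by
    refine monotoneOn_of_hasDerivWithinAt_nonneg
      (f' := fun t => t * (Real.sin t - t * Real.cos t) + t ^ 3 / 3 * Real.sin t)
      (convex_Icc _ _) (by fun_prop) (fun x hx => ?_) (fun x hx => ?_)
    · refine ((Real.hasDerivAt_sin x).sub (((hasDerivAt_id x).add
        ((hasDerivAt_pow 3 x).div_const 3)).mul
          (Real.hasDerivAt_cos x))).hasDerivWithinAt.congr_deriv ?_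
      simp
      ring
    · rw [interior_Icc] at hx
      have h2 := mul_cos_le_sin hx.1.le (by linarith [hx.2])
      have h3 := Real.sin_nonneg_of_nonneg_of_le_pi hx.1.le (by linarith [hx.2])
      have hx0 := hx.1
      have := sub_nonneg.mpr h2
      positivity
  have hanti : AntitoneOn (fun t : ℝ => Real.cos t * Real.exp (t ^ 2 / 2 + t ^ 4 / 12))
      (Set.Icc 0 (Real.pi / 2)) := by
    refine antitoneOn_of_hasDerivWithinAt_nonpos
      (f' := fun t => ((t + t ^ 3 / 3) * Real.cos t - Real.sin t) *
        Real.exp (t ^ 2 / 2 + t ^ 4 / 12))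
      (convex_Icc _ _) (by fun_prop) (fun x hx => ?_) (fun x hx => ?_)
    · refine ((Real.hasDerivAt_cos x).mul (((hasDerivAt_pow 2 x).div_const 2).add
        ((hasDerivAt_pow 4 x).div_const 12)).exp).hasDerivWithinAt.congr_deriv ?_
      simp
      ring
    · rw [interior_Icc] at hx
      have := hL ⟨le_rfl, by positivity⟩ ⟨hx.1.le, hx.2.le⟩ hx.1.le
      simp at this
      exact mul_nonpos_of_nonpos_of_nonneg (by linarith) (Real.exp_pos _).le
  have := hanti ⟨le_rfl, by positivity⟩ ⟨h0, h1⟩ h0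
  simp at this
  rw [Real.exp_neg, ← one_div, le_div_iff₀ (Real.exp_pos _)]
  exact this

lemma mul_sin_le_sin_mul {l x : ℝ} (h0 : 0 ≤ l) (h1 : l ≤ 1) (hx0 : 0 ≤ x) (hx : x ≤ Real.pi) :
    l * Real.sin x ≤ Real.sin (l * x) := by
  have := strictConcaveOn_sin_Icc.concaveOn.2 (x := x) (y := 0) ⟨hx0, hx⟩ ⟨le_rfl, Real.pi_pos.le⟩
    h0 (sub_nonneg.mpr h1) (by ring)
  simpa using this

/-- The Gaussian majorant of the main lobe that is used for the factor `f_m ^ p`. -/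
lemma fejer_le_exp {m : ℕ} (hm : 1 ≤ m) {θ : ℝ} (h0 : 0 < θ) (h1 : m * θ ≤ Real.pi) :
    fejer m θ ≤ Real.exp (-(((m : ℝ) ^ 2 - 1) / 3 * θ ^ 2)) := by
  have hm1 : (1 : ℝ) ≤ m := by exact_mod_cast hm
  have hθm : θ ≤ m * θ := le_mul_of_one_le_left h0.le hm1
  have hmθ : 0 < m * θ := by positivity
  have h := sin_div_mul_exp_antitone ⟨h0, hθm.trans h1⟩ ⟨hmθ, h1⟩ hθm
  have hs : 0 ≤ Real.sin (m * θ) := Real.sin_nonneg_of_nonneg_of_le_pi hmθ.le h1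
  have hs1 : 0 < Real.sin θ ∨ m = 1 := by
    rcases hm.eq_or_lt with rfl | hm2
    · exact Or.inr rfl
    · left
      have : (2 : ℝ) ≤ m := by exact_mod_cast hm2
      exact Real.sin_pos_of_pos_of_lt_pi h0 (by nlinarith)
  rcases hs1 with hs1 | rfl
  · have h2 : Real.sin (m * θ) / (m * Real.sin θ) ≤
        Real.exp (-(((m : ℝ) ^ 2 - 1) / 6 * θ ^ 2)) := by
      have e : Real.exp ((m * θ) ^ 2 / 6) =
          Real.exp (((m : ℝ) ^ 2 - 1) / 6 * θ ^ 2) * Real.exp (θ ^ 2 / 6) := by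
        rw [← Real.exp_add]; ring_nf
      simp only [e] at h
      rw [Real.exp_neg, ← one_div, div_le_div_iff₀ (by positivity) (Real.exp_pos _)]
      have h3 : Real.sin (m * θ) / (m * θ) * Real.exp (((m : ℝ) ^ 2 - 1) / 6 * θ ^ 2) ≤
          Real.sin θ / θ := by
        refine le_of_mul_le_mul_right ?_ (Real.exp_pos (θ ^ 2 / 6))
        rw [mul_assoc]; exact h
      rw [div_mul_eq_mul_div, div_le_div_iff₀ hmθ h0] at h3
      have h4 : Real.sin (m * θ) * Real.exp (((m : ℝ) ^ 2 - 1) / 6 * θ ^ 2) * θ ≤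
          1 * (m * Real.sin θ) * θ := by refine h3.trans_eq (by ring)
      exact le_of_mul_le_mul_right h4 h0
    rw [fejer]
    refine (pow_le_pow_left₀ (by positivity) h2 2).trans_eq ?_
    rw [← Real.exp_nat_mul]
    congr 1
    push_cast
    ring
  · refine (fejer_le_one 1 θ).trans_eq ?_
    simp

/-- Monotonicity in `m` reduces the estimates for `m ≥ 4` to `m = 4`. -/
lemma fejer_le_cos_sq {m : ℕ} (hm : 4 ≤ m) {θ : ℝ} (h0 : 0 < θ) (h1 : m * θ ≤ 2 * Real.pi) :
    fejer m θ ≤ Real.cos (m * θ / 4) ^ 2 * Real.cos (m * θ / 2) ^ 2 := by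
  have hm4 : (4 : ℝ) ≤ m := by exact_mod_cast hm
  have hpi := Real.pi_pos
  have hmθ : 0 < m * θ := by positivity
  have hs : 0 < Real.sin (m * θ / 4) :=
    Real.sin_pos_of_pos_of_lt_pi (by positivity) (by linarith)
  have h2 : 4 * Real.sin (m * θ / 4) ≤ m * Real.sin θ := by
    have := mul_sin_le_sin_mul (l := 4 / m) (x := m * θ / 4) (by positivity)
      (div_le_one_of_le₀ hm4 (by positivity)) (by positivity) (by linarith)
    rw [show 4 / (m : ℝ) * (m * θ / 4) = θ by field_simp, div_mul_eq_mul_div,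
      div_le_iff₀ (by positivity)] at this
    linarith
  have h3 : Real.sin (m * θ) =
      4 * Real.sin (m * θ / 4) * (Real.cos (m * θ / 4) * Real.cos (m * θ / 2)) := by
    rw [show m * θ = 2 * (m * θ / 2) by ring, Real.sin_two_mul,
      show 2 * (m * θ / 2) / 4 = m * θ / 4 by ring, show 2 * (m * θ / 2) / 2 = m * θ / 2 by ring]
    have h4 : Real.sin (m * θ / 2) = 2 * Real.sin (m * θ / 4) * Real.cos (m * θ / 4) := by
      rw [← Real.sin_two_mul]; ring_nf
    rw [h4]; ring
  rw [← mul_pow, fejer, sq_le_sq, abs_div, h3, abs_mul,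
    abs_of_pos (by positivity : 0 < 4 * Real.sin (m * θ / 4)),
    abs_of_pos (lt_of_lt_of_le (by positivity) h2)]
  rw [div_le_iff₀ (lt_of_lt_of_le (by positivity) h2), mul_comm]
  exact mul_le_mul_of_nonneg_left h2 (abs_nonneg _)

/-- The Gaussian majorant of the main lobe that is used for the remaining factor `f_m`: in
`u = m θ` it is independent of `m`, and `1.01` is smaller than `√(π / 3)`, which makes its total mass
smaller than that of `f_m`. -/
lemma fejer_le_gaussian {m : ℕ} (hm : 4 ≤ m) {θ : ℝ} (h0 : 0 < θ) (h1 : m * θ ≤ Real.pi) :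
    fejer m θ ≤ 1.01 * Real.exp (-((m : ℝ) ^ 2 / 3 * θ ^ 2)) := by
  have hpi := Real.pi_pos
  refine (fejer_le_cos_sq hm h0 (by linarith)).trans ?_
  set u := m * θ with hu
  have hu0 : 0 < u := by
    have : (4 : ℝ) ≤ m := by exact_mod_cast hm
    positivity
  have c1 := cos_le_exp (t := u / 4) (by positivity) (by linarith)
  have c2 := cos_le_exp (t := u / 2) (by positivity) (by linarith)
  have p1 : 0 ≤ Real.cos (u / 4) := Real.cos_nonneg_of_mem_Icc ⟨by linarith, by linarith⟩
  have p2 : 0 ≤ Real.cos (u / 2) := Real.cos_nonneg_of_mem_Icc ⟨by linarith, by linarith⟩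
  have hA : Real.exp 0.0099 ≤ 1.01 := by
    have h := Real.add_one_le_exp (-0.0099 : ℝ)
    have e : Real.exp 0.0099 = (Real.exp (-0.0099))⁻¹ := by rw [Real.exp_neg, inv_inv]
    rw [e]
    exact inv_le_of_inv_le₀ (by norm_num) (by norm_num at h ⊢; linarith)
  calc Real.cos (u / 4) ^ 2 * Real.cos (u / 2) ^ 2
      ≤ Real.exp (-((u / 4) ^ 2 / 2 + (u / 4) ^ 4 / 12)) ^ 2 *
        Real.exp (-((u / 2) ^ 2 / 2 + (u / 2) ^ 4 / 12)) ^ 2 := by gcongr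
    _ = Real.exp (u ^ 2 / 48 - 17 * u ^ 4 / 1536 + -(u ^ 2 / 3)) := by
        rw [← Real.exp_nat_mul, ← Real.exp_nat_mul, ← Real.exp_add]
        congr 1; push_cast; ring
    _ ≤ Real.exp (0.0099 + -(u ^ 2 / 3)) := by
        refine Real.exp_le_exp.mpr ?_
        -- the maximum is attained at `u² = 16 / 17`
        nlinarith [sq_nonneg (u ^ 2 - 0.9411)]
    _ ≤ _ := by
        rw [Real.exp_add, hu, mul_pow]
        rw [mul_div_right_comm]
        exact mul_le_mul_of_nonneg_right hA (Real.exp_pos _).le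

/-- The level `exp (-13/5)` is slightly above `2/27`, the height of the side lobe for `m = 4`. -/
lemma exp_bounds : Real.exp (-(13 / 5)) ≤ 0.0744 ∧ (2 / 27 : ℝ) ≤ Real.exp (-(13 / 5)) := by
  have h5 : Real.exp (-(13 / 5)) ^ 5 * Real.exp 1 ^ 13 = 1 := by
    rw [← Real.exp_nat_mul, ← Real.exp_nat_mul, ← Real.exp_add, ← Real.exp_zero]
    congr 1; norm_num
  set x := Real.exp (-(13 / 5)) with hx
  have hx0 : 0 < x := Real.exp_pos _
  have hl : (2.7182818283 : ℝ) ^ 13 ≤ Real.exp 1 ^ 13 :=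
    pow_le_pow_left₀ (by norm_num) Real.exp_one_gt_d9.le 13
  have hu : Real.exp 1 ^ 13 ≤ (2.7182818286 : ℝ) ^ 13 :=
    pow_le_pow_left₀ (Real.exp_pos 1).le Real.exp_one_lt_d9.le 13
  have key : ∀ a : ℝ, 0 ≤ a → a ^ 5 * (2.7182818286 : ℝ) ^ 13 ≤ 1 → a ≤ x := by
    intro a ha h
    by_contra hlt
    have h1 : x ^ 5 < a ^ 5 := pow_lt_pow_left₀ (not_le.mp hlt) hx0.le (by norm_num)
    have h2 : x ^ 5 * Real.exp 1 ^ 13 < a ^ 5 * Real.exp 1 ^ 13 :=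
      mul_lt_mul_of_pos_right h1 (by positivity)
    have h3 : a ^ 5 * Real.exp 1 ^ 13 ≤ a ^ 5 * (2.7182818286 : ℝ) ^ 13 :=
      mul_le_mul_of_nonneg_left hu (by positivity)
    linarith
  refine ⟨?_, key _ (by norm_num) (by norm_num)⟩
  by_contra hlt
  have h1 : (0.0744 : ℝ) ^ 5 < x ^ 5 := pow_lt_pow_left₀ (not_le.mp hlt) (by norm_num) (by norm_num)
  have h2 : (0.0744 : ℝ) ^ 5 * (2.7182818283 : ℝ) ^ 13 ≤ x ^ 5 * Real.exp 1 ^ 13 :=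
    mul_le_mul h1.le hl (by positivity) (by positivity)
  rw [h5] at h2
  norm_num at h2

/-- The side lobes of the Fejér kernel. -/
lemma fejer_sideLobe {m : ℕ} (hm : 4 ≤ m) {θ : ℝ} (h1 : Real.pi ≤ m * θ) (h2 : θ ≤ Real.pi / 2) :
    fejer m θ ≤ Real.exp (-(13 / 5)) := by
  refine le_trans ?_ exp_bounds.2
  have hm4 : (4 : ℝ) ≤ m := by exact_mod_cast hm
  have hpi := Real.pi_pos
  have h0 : 0 < θ := by
    by_contra h
    have : m * θ ≤ 0 := mul_nonpos_of_nonneg_of_nonpos (by positivity) (not_lt.mp h)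
    linarith
  rcases le_total (m * θ) (2 * Real.pi) with h3 | h3
  · refine (fejer_le_cos_sq hm h0 h3).trans ?_
    set x := Real.cos (m * θ / 2) with hx
    have hx0 : x ≤ 0 := Real.cos_nonpos_of_pi_div_two_le_of_le (by linarith) (by linarith)
    have hx4 : Real.cos (m * θ / 4) ^ 2 = (1 + x) / 2 := by
      rw [Real.cos_sq, hx]; ring_nf
    rw [hx4]
    -- `(1 + x) x² / 2` has its maximum `2/27` on `[-1, 0]` at `x = -2/3`
    have : 0 ≤ (x + 2 / 3) ^ 2 * (1 / 3 - x) := mul_nonneg (sq_nonneg _) (by linarith)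
    nlinarith
  · have hs : 4 ≤ m * Real.sin θ := by
      have h4 : Real.sin (2 * Real.pi / m) ≤ Real.sin θ := by
        refine Real.sin_le_sin_of_le_of_le_pi_div_two ?_ h2 ?_
        · have : 0 ≤ 2 * Real.pi / m := by positivity
          linarith
        · rw [div_le_iff₀ (by positivity)]; linarith
      have h5 := mul_sin_le_sin_mul (l := 4 / m) (x := Real.pi / 2) (by positivity)
        (div_le_one_of_le₀ hm4 (by positivity)) (by positivity) (by linarith)
      rw [Real.sin_pi_div_two, show 4 / (m : ℝ) * (Real.pi / 2) = 2 * Real.pi / m by ring] at h5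
      have h6 : 4 / m ≤ Real.sin θ := by linarith
      rw [div_le_iff₀ (by positivity)] at h6
      linarith
    have h7 : |Real.sin (m * θ) / (m * Real.sin θ)| ≤ 1 / 4 := by
      rw [abs_div, abs_of_pos (by linarith : 0 < m * Real.sin θ)]
      exact div_le_div₀ zero_le_one (Real.abs_sin_le_one _) (by norm_num) hs
    rw [fejer, ← sq_abs]
    calc _ ≤ (1 / 4 : ℝ) ^ 2 := pow_le_pow_left₀ (abs_nonneg _) h7 2
      _ ≤ _ := by norm_num

/-- Tail integral `∫_a^∞ θ (B θ² - R) exp (-B θ²) dθ` with `B a² = R`. -/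
lemma integral_tail {B R a : ℝ} (hB : 0 < B) (ha : 0 < a) (hR : B * a ^ 2 = R) :
    IntegrableOn (fun θ : ℝ => θ * (B * θ ^ 2 - R) * Real.exp (-(B * θ ^ 2))) (Set.Ioi a) ∧
    ∫ θ in Set.Ioi a, θ * (B * θ ^ 2 - R) * Real.exp (-(B * θ ^ 2)) =
      Real.exp (-R) / (2 * B) := by
  have hd : ∀ x ∈ Set.Ici a, HasDerivAt
      (fun θ : ℝ => -((B * θ ^ 2 - R + 1) * Real.exp (-(B * θ ^ 2))) / (2 * B))
      (x * (B * x ^ 2 - R) * Real.exp (-(B * x ^ 2))) x := by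
    intro x _
    have h1 : HasDerivAt (fun θ : ℝ => B * θ ^ 2) (B * (2 * x)) x := by
      simpa using (hasDerivAt_pow 2 x).const_mul B
    refine (((((h1.sub_const R).add_const 1).mul h1.neg.exp).neg).div_const (2 * B)).congr_deriv ?_
    simp only [Pi.neg_apply]
    field_simp
    ring
  have hpos : ∀ x ∈ Set.Ioi a, 0 ≤ x * (B * x ^ 2 - R) * Real.exp (-(B * x ^ 2)) := by
    intro x hx
    have hx' : a < x := hx
    have : R ≤ B * x ^ 2 := by
      rw [← hR]; exact mul_le_mul_of_nonneg_left (pow_le_pow_left₀ ha.le hx'.le 2) hB.le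
    exact mul_nonneg (mul_nonneg (by linarith) (by linarith)) (Real.exp_pos _).le
  have hlim : Filter.Tendsto
      (fun θ : ℝ => -((B * θ ^ 2 - R + 1) * Real.exp (-(B * θ ^ 2))) / (2 * B))
      Filter.atTop (nhds 0) := by
    have h1 : Filter.Tendsto (fun θ : ℝ => B * θ ^ 2) Filter.atTop Filter.atTop :=
      (Filter.tendsto_pow_atTop two_ne_zero).const_mul_atTop hB
    have h2 : Filter.Tendsto (fun y : ℝ => y * Real.exp (-y)) Filter.atTop (nhds 0) := by
      simpa using Real.tendsto_pow_mul_exp_neg_atTop_nhds_zero 1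
    have h3 : Filter.Tendsto (fun y : ℝ => Real.exp (-y)) Filter.atTop (nhds 0) :=
      Real.tendsto_exp_neg_atTop_nhds_zero
    have h4 := (((h2.add (h3.const_mul (1 - R))).neg).div_const (2 * B)).comp h1
    simp only [mul_zero, add_zero, neg_zero, zero_div] at h4
    refine h4.congr fun θ => ?_
    simp only [Function.comp]
    ring
  refine ⟨integrableOn_Ioi_deriv_of_nonneg' hd hpos hlim, ?_⟩
  rw [integral_Ioi_of_hasDerivAt_of_nonneg' hd hpos hlim, hR]
  ring

/-- The inequality that remains for `m ≥ 4` after all integrals are evaluated; there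
`t = m / √(m² + p (m² - 1))`. -/
lemma fejer_large_numeric {p t : ℝ} (hp : 0 ≤ p) (ht : Real.exp (-(p / 2)) ≤ t) :
    Real.exp (-(13 / 5 * p)) + 1.01 * √(3 / Real.pi) * (t - Real.exp (-(13 / 5 * p))) +
      Real.exp (-(13 / 5 * p)) * p *
        (1.01 * (√3 / Real.pi) * Real.exp (-(13 / 5)) / √(13 / 5)) ≤ t := by
  have hpi := Real.pi_pos
  have hpi4 := Real.pi_gt_d4
  have hk : √(3 / Real.pi) ≤ 0.9773 := by
    refine (Real.sqrt_le_left (by norm_num)).mpr ?_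
    rw [div_le_iff₀ hpi]
    nlinarith
  set ε := 1 - 1.01 * √(3 / Real.pi) with hε
  have hε1 : 0.0129 ≤ ε := by rw [hε]; linarith
  have hτ : 1.01 * (√3 / Real.pi) * Real.exp (-(13 / 5)) / √(13 / 5) ≤ 0.0258 := by
    have h1 : √3 ≤ 1.7321 := (Real.sqrt_le_left (by norm_num)).mpr (by norm_num)
    have h2 : 1.612 ≤ √(13 / 5) := Real.le_sqrt_of_sq_le (by norm_num)
    have h3 := exp_bounds.1
    calc 1.01 * (√3 / Real.pi) * Real.exp (-(13 / 5)) / √(13 / 5)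
        ≤ 1.01 * (1.7321 / 3.1415) * 0.0744 / 1.612 := by gcongr
      _ ≤ 0.0258 := by norm_num
  set E := Real.exp (-(13 / 5 * p)) with hE
  have hE0 : 0 < E := Real.exp_pos _
  have h1 : E * (1 + 2.1 * p) ≤ t := by
    refine le_trans ?_ ht
    have : 1 + 2.1 * p ≤ Real.exp (2.1 * p) := by linarith [Real.add_one_le_exp (2.1 * p)]
    calc E * (1 + 2.1 * p) ≤ E * Real.exp (2.1 * p) := by gcongr
      _ = Real.exp (-(p / 2)) := by rw [hE, ← Real.exp_add]; congr 1; ring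
  have h2 : E * p * (1.01 * (√3 / Real.pi) * Real.exp (-(13 / 5)) / √(13 / 5)) ≤
      E * p * (ε * 2.1) := by
    refine mul_le_mul_of_nonneg_left ?_ (by positivity)
    linarith
  have h3 : ε * (E * (1 + 2.1 * p)) ≤ ε * t := mul_le_mul_of_nonneg_left h1 (by linarith)
  have h4 : 1.01 * √(3 / Real.pi) = 1 - ε := by rw [hε]; ring
  rw [h4]
  linarith

/-- The discrete Ball inequality for `m ≥ 4`. With `E = exp (-13 p / 5)`, `B = m²/3`, `b = (m² - 1)/3`
and `R = 13/5`, the kernel satisfies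
`f^(1+p) ≤ E f + 1.01 exp (-B θ²) (exp (-p b θ²) - E + E p (B θ² - R)₊)`;
the last term compensates for the region in which `exp (-p b θ²) < E`. -/
theorem integral_fejer_large {m : ℕ} (hm : 4 ≤ m) {q : ℝ} (hq : 1 ≤ q) :
    ∫ θ in (0 : ℝ)..(Real.pi / 2), fejer m θ ^ q ≤
      Real.pi / 2 / √(1 + q * ((m : ℝ) ^ 2 - 1)) := by
  obtain ⟨p, rfl⟩ : ∃ p, q = 1 + p := ⟨q - 1, by ring⟩
  have hp : 0 ≤ p := by linarith
  have hpi := Real.pi_pos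
  have hm4 : (4 : ℝ) ≤ m := by exact_mod_cast hm
  have hm0 : (0 : ℝ) < m := by linarith
  set E : ℝ := Real.exp (-(13 / 5 * p)) with hE
  have hE0 : 0 < E := Real.exp_pos _
  set B : ℝ := (m : ℝ) ^ 2 / 3 with hB
  have hB0 : 0 < B := by positivity
  set b : ℝ := ((m : ℝ) ^ 2 - 1) / 3 with hb
  have hb0 : 0 < b := by rw [hb]; nlinarith
  have hbB : b ≤ B := by rw [hb, hB]; linarith
  set a : ℝ := √(13 / 5 / B) with ha
  have ha0 : 0 < a := Real.sqrt_pos.mpr (by positivity)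
  have haR : B * a ^ 2 = 13 / 5 := by
    rw [ha, Real.sq_sqrt (by positivity)]; field_simp
  obtain ⟨hTi, hTv⟩ := integral_tail hB0 ha0 haR
  -- `K` dominates `(B θ² - 13/5)₊ exp (-B θ²)`
  set K : ℝ → ℝ := (Set.Ioi a).indicator
    (fun θ : ℝ => a⁻¹ * (θ * (B * θ ^ 2 - 13 / 5) * Real.exp (-(B * θ ^ 2)))) with hK
  set G : ℝ → ℝ := fun θ => 1.01 * (Real.exp (-(B + p * b) * θ ^ 2) -
    E * Real.exp (-B * θ ^ 2) + E * p * K θ) with hG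
  have hFE : ∀ θ : ℝ, 0 < θ → 0 ≤ Real.exp (-(B * θ ^ 2)) *
      (Real.exp (-(p * (b * θ ^ 2))) - E) + E * p * K θ := by
    intro θ hθ
    have h1 : E - Real.exp (-(p * (b * θ ^ 2))) ≤ E * (p * (B * θ ^ 2 - 13 / 5)) := by
      have h2 : Real.exp (-(p * (B * θ ^ 2))) ≤ Real.exp (-(p * (b * θ ^ 2))) := by
        refine Real.exp_le_exp.mpr (neg_le_neg ?_)
        gcongr
      have h3 : Real.exp (-(p * (B * θ ^ 2))) = E * Real.exp (-(p * (B * θ ^ 2 - 13 / 5))) := by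
        rw [hE, ← Real.exp_add]; congr 1; ring
      have h4 := Real.add_one_le_exp (-(p * (B * θ ^ 2 - 13 / 5)))
      have h5 : E * (-(p * (B * θ ^ 2 - 13 / 5)) + 1) ≤ Real.exp (-(p * (B * θ ^ 2))) := by
        rw [h3]; exact mul_le_mul_of_nonneg_left h4 hE0.le
      linarith
    have hg := Real.exp_pos (-(B * θ ^ 2))
    by_cases hθa : a < θ
    · have hKθ : K θ = a⁻¹ * (θ * (B * θ ^ 2 - 13 / 5) * Real.exp (-(B * θ ^ 2))) := by
        rw [hK, Set.indicator_of_mem (show θ ∈ Set.Ioi a from hθa)]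
      have hy : 0 ≤ B * θ ^ 2 - 13 / 5 := by
        rw [← haR, sub_nonneg]
        exact mul_le_mul_of_nonneg_left (pow_le_pow_left₀ ha0.le hθa.le 2) hB0.le
      have h6 : (B * θ ^ 2 - 13 / 5) * Real.exp (-(B * θ ^ 2)) ≤ K θ := by
        rw [hKθ, show a⁻¹ * (θ * (B * θ ^ 2 - 13 / 5) * Real.exp (-(B * θ ^ 2))) =
          θ / a * ((B * θ ^ 2 - 13 / 5) * Real.exp (-(B * θ ^ 2))) by ring]
        refine le_mul_of_one_le_left (by positivity) ?_
        rw [le_div_iff₀ ha0]; linarith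
      have h7 := mul_le_mul_of_nonneg_left h6 (by positivity : 0 ≤ E * p)
      have h8 := mul_le_mul_of_nonneg_left h1 hg.le
      nlinarith
    · have hKθ : K θ = 0 := by rw [hK, Set.indicator_of_notMem (by simpa using hθa)]
      have hy : B * θ ^ 2 - 13 / 5 ≤ 0 := by
        rw [← haR, sub_nonpos]
        exact mul_le_mul_of_nonneg_left (pow_le_pow_left₀ hθ.le (not_lt.mp hθa) 2) hB0.le
      have h6 : E * (p * (B * θ ^ 2 - 13 / 5)) ≤ 0 :=
        mul_nonpos_of_nonneg_of_nonpos hE0.le (mul_nonpos_of_nonneg_of_nonpos hp hy)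
      rw [hKθ, mul_zero, add_zero]
      exact mul_nonneg hg.le (by linarith)
  have hGeq : ∀ θ, G θ = 1.01 * (Real.exp (-(B * θ ^ 2)) *
      (Real.exp (-(p * (b * θ ^ 2))) - E) + E * p * K θ) := by
    intro θ
    simp only [hG]
    rw [show -(B + p * b) * θ ^ 2 = -(B * θ ^ 2) + -(p * (b * θ ^ 2)) by ring, Real.exp_add,
      show -B * θ ^ 2 = -(B * θ ^ 2) by ring]
    ring
  have hG0 : ∀ θ, 0 < θ → 0 ≤ G θ := fun θ hθ => by
    rw [hGeq]; exact mul_nonneg (by norm_num) (hFE θ hθ)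
  have hK0 : ∀ θ, 0 ≤ K θ := by
    intro θ
    refine Set.indicator_nonneg (fun x hx => ?_) θ
    have hx' : a < x := hx
    have hy : 0 ≤ B * x ^ 2 - 13 / 5 := by
      rw [← haR, sub_nonneg]
      exact mul_le_mul_of_nonneg_left (pow_le_pow_left₀ ha0.le hx'.le 2) hB0.le
    have : 0 < x := ha0.trans hx'
    positivity
  have hpt : ∀ θ, 0 < θ → θ ≤ Real.pi / 2 → fejer m θ ^ (1 + p) ≤ E * fejer m θ + G θ := by
    intro θ h0 h1
    have hf0 := fejer_nonneg m θ
    rw [Real.rpow_add' hf0 (by linarith), Real.rpow_one]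
    rcases le_total (m * θ) Real.pi with h2 | h2
    · have hF : fejer m θ ^ p ≤ Real.exp (-(p * (b * θ ^ 2))) := by
        have := Real.rpow_le_rpow hf0 (fejer_le_exp (by omega) h0 h2) hp
        rw [← Real.exp_mul] at this
        refine this.trans_eq ?_
        rw [hb]; ring_nf
      have hD := fejer_le_gaussian hm h0 h2
      have hg := Real.exp_pos (-(B * θ ^ 2))
      rw [hGeq]
      have h3 := mul_le_mul_of_nonneg_left hF hf0
      have hKE : 0 ≤ E * p * K θ := mul_nonneg (by positivity) (hK0 θ)
      rcases le_total E (Real.exp (-(p * (b * θ ^ 2)))) with h4 | h4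
      · have h5 := mul_le_mul_of_nonneg_right hD (sub_nonneg.mpr h4)
        linarith
      · have h5 : fejer m θ * (Real.exp (-(p * (b * θ ^ 2))) - E) ≤ 0 :=
          mul_nonpos_of_nonneg_of_nonpos hf0 (by linarith)
        linarith [hFE θ h0]
    · have hF : fejer m θ ^ p ≤ E := by
        have := Real.rpow_le_rpow hf0 (fejer_sideLobe hm h2 h1) hp
        rw [← Real.exp_mul] at this
        refine this.trans_eq ?_
        rw [hE]; ring_nf
      have h3 := mul_le_mul_of_nonneg_left hF hf0
      linarith [hG0 θ h0]
  have hgi : ∀ c : ℝ, 0 < c → IntegrableOn (fun θ : ℝ => Real.exp (-c * θ ^ 2)) (Set.Ioi 0) :=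
    fun c hc => (integrable_exp_neg_mul_sq hc).integrableOn
  have hBp : 0 < B + p * b := by positivity
  have hKi : IntegrableOn K (Set.Ioi 0) := by
    rw [hK]
    exact ((integrable_indicator_iff measurableSet_Ioi).mpr (hTi.const_mul a⁻¹)).integrableOn
  have hKv : ∫ θ in Set.Ioi 0, K θ = a⁻¹ * (Real.exp (-(13 / 5)) / (2 * B)) := by
    rw [hK, setIntegral_indicator measurableSet_Ioi,
      Set.inter_eq_right.mpr (Set.Ioi_subset_Ioi ha0.le), integral_const_mul, hTv]
  have hGi : IntegrableOn G (Set.Ioi 0) :=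
    ((((hgi _ hBp).sub ((hgi B hB0).const_mul E))).add (hKi.const_mul (E * p))).const_mul 1.01
  have hGv : ∫ θ in Set.Ioi 0, G θ = 1.01 * (√(Real.pi / (B + p * b)) / 2 -
      E * (√(Real.pi / B) / 2) + E * p * (a⁻¹ * (Real.exp (-(13 / 5)) / (2 * B)))) := by
    simp only [hG]
    have hsub : IntegrableOn (fun θ : ℝ => Real.exp (-(B + p * b) * θ ^ 2) -
        E * Real.exp (-B * θ ^ 2)) (Set.Ioi 0) := (hgi _ hBp).sub ((hgi B hB0).const_mul E)
    rw [integral_const_mul, integral_add hsub (hKi.const_mul (E * p)),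
      integral_sub (hgi _ hBp) ((hgi B hB0).const_mul E),
      integral_const_mul, integral_const_mul, integral_gaussian_Ioi, integral_gaussian_Ioi, hKv]
  have hi1 : IntervalIntegrable (fun θ => fejer m θ) volume 0 (Real.pi / 2) := by
    simpa using intervalIntegrable_fejer_rpow m zero_le_one 0 (Real.pi / 2)
  have hGii : IntervalIntegrable G volume 0 (Real.pi / 2) := by
    rw [intervalIntegrable_iff_integrableOn_Ioc_of_le (by positivity)]
    exact hGi.mono_set Set.Ioc_subset_Ioi_self
  have step1 : ∫ θ in (0 : ℝ)..(Real.pi / 2), fejer m θ ^ (1 + p) ≤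
      E * (Real.pi / (2 * m)) + ∫ θ in Set.Ioi 0, G θ := by
    calc ∫ θ in (0 : ℝ)..(Real.pi / 2), fejer m θ ^ (1 + p)
        ≤ ∫ θ in (0 : ℝ)..(Real.pi / 2), (E * fejer m θ + G θ) :=
          intervalIntegral.integral_mono_on_of_le_Ioo (by positivity)
            (intervalIntegrable_fejer_rpow m (by linarith) _ _) ((hi1.const_mul E).add hGii)
            fun θ hθ => hpt θ hθ.1 hθ.2.le
      _ = E * (Real.pi / (2 * m)) + ∫ θ in Set.Ioc 0 (Real.pi / 2), G θ := by
          rw [intervalIntegral.integral_add (hi1.const_mul E) hGii,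
            intervalIntegral.integral_const_mul, integral_fejer (by omega),
            intervalIntegral.integral_of_le (f := G) (by positivity)]
      _ ≤ _ := by
          refine add_le_add le_rfl (setIntegral_mono_set hGi ?_
            Set.Ioc_subset_Ioi_self.eventuallyLE)
          exact (ae_restrict_iff' measurableSet_Ioi).mpr
            (Filter.Eventually.of_forall fun θ hθ => hG0 θ hθ)
  refine step1.trans ?_
  rw [hGv]
  -- normalise by the factor `π / (2 m)`
  set D : ℝ := 1 + (1 + p) * ((m : ℝ) ^ 2 - 1) with hD
  have hD0 : 0 < D := by rw [hD]; nlinarith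
  set t : ℝ := m / √D with ht
  have hsD : 0 < √D := Real.sqrt_pos.mpr hD0
  have e1 : √(Real.pi / (B + p * b)) / 2 = Real.pi / (2 * m) * (√(3 / Real.pi) * t) := by
    have h1 : Real.pi / (B + p * b) = Real.pi ^ 2 * (3 / Real.pi) / D := by
      have : B + p * b = D / 3 := by rw [hB, hb, hD]; ring
      rw [this]; field_simp
    rw [h1, Real.sqrt_div (by positivity), Real.sqrt_mul (by positivity),
      Real.sqrt_sq hpi.le, ht]
    field_simp
  have e2 : √(Real.pi / B) / 2 = Real.pi / (2 * m) * √(3 / Real.pi) := by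
    have h1 : Real.pi / B = (Real.pi / m) ^ 2 * (3 / Real.pi) := by rw [hB]; field_simp
    rw [h1, Real.sqrt_mul (by positivity), Real.sqrt_sq (by positivity)]
    field_simp
  have e3 : a⁻¹ * (Real.exp (-(13 / 5)) / (2 * B)) =
      Real.pi / (2 * m) * (√3 / Real.pi * Real.exp (-(13 / 5)) / √(13 / 5)) := by
    have h1 : a = √(13 / 5) * √3 / m := by
      rw [ha, hB, ← Real.sqrt_mul (by norm_num), show 13 / 5 / ((m : ℝ) ^ 2 / 3) =
        13 / 5 * 3 / (m : ℝ) ^ 2 by field_simp, Real.sqrt_div (by norm_num),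
        Real.sqrt_sq hm0.le]
    have h3 : √3 ^ 2 = (3 : ℝ) := Real.sq_sqrt (by norm_num)
    have h4 : 0 < √(13 / 5 : ℝ) := Real.sqrt_pos.mpr (by norm_num)
    rw [h1, hB]
    field_simp
    rw [h3]
  have htl : Real.exp (-(p / 2)) ≤ t := by
    rw [Real.exp_neg, ← one_div, ht, div_le_div_iff₀ (Real.exp_pos _) hsD, one_mul,
      Real.sqrt_le_left (by positivity), mul_pow, ← Real.exp_nat_mul]
    push_cast
    rw [show 2 * (p / 2) = p by ring]
    have := Real.add_one_le_exp p
    have h2 : (m : ℝ) ^ 2 * (p + 1) ≤ (m : ℝ) ^ 2 * Real.exp p := by gcongr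
    rw [hD]
    nlinarith
  have hnum := fejer_large_numeric hp htl
  rw [← hE] at hnum
  rw [e1, e2, e3]
  have hfin := mul_le_mul_of_nonneg_left hnum (by positivity : 0 ≤ Real.pi / (2 * m))
  have hend : Real.pi / (2 * m) * t = Real.pi / 2 / √D := by rw [ht]; field_simp
  rw [hend] at hfin
  refine le_trans (le_of_eq ?_) hfin
  ring

/-! ### The discrete Ball inequality and Hölder's inequality -/

/-- A discrete analogue of Ball's integral inequality, with equality at `q = 1`. -/
theorem integral_fejer_rpow_le {m : ℕ} (hm : 2 ≤ m) {q : ℝ} (hq : 1 ≤ q) :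
    ∫ θ in (0 : ℝ)..Real.pi, fejer m θ ^ q ≤ Real.pi / √(1 + q * ((m : ℝ) ^ 2 - 1)) := by
  rw [integral_fejer_rpow_eq m (by linarith)]
  have h : ∫ θ in (0 : ℝ)..(Real.pi / 2), fejer m θ ^ q ≤
      Real.pi / 2 / √(1 + q * ((m : ℝ) ^ 2 - 1)) := by
    rcases hm.eq_or_lt with rfl | hm
    · refine (integral_fejer_two hq).trans_eq ?_
      norm_num
    rcases (show 3 ≤ m from hm).eq_or_lt with rfl | hm
    · refine (integral_fejer_three hq).trans_eq ?_
      norm_num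
    · exact integral_fejer_large hm hq
  calc 2 * ∫ θ in (0 : ℝ)..(Real.pi / 2), fejer m θ ^ q
      ≤ 2 * (Real.pi / 2 / √(1 + q * ((m : ℝ) ^ 2 - 1))) := by gcongr
    _ = _ := by ring

lemma lintegral_fejer_rpow_le {m : ℕ} (hm : 2 ≤ m) {q : ℝ} (hq : 1 ≤ q) :
    ∫⁻ θ in Set.Ioc 0 Real.pi, ENNReal.ofReal (fejer m θ ^ q) ≤
      ENNReal.ofReal (Real.pi / √(1 + q * ((m : ℝ) ^ 2 - 1))) := by
  have hi := intervalIntegrable_fejer_rpow m (by linarith : 0 ≤ q) 0 Real.pi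
  rw [intervalIntegrable_iff_integrableOn_Ioc_of_le Real.pi_pos.le] at hi
  rw [← ofReal_integral_eq_lintegral_ofReal hi
    (Filter.Eventually.of_forall fun θ => Real.rpow_nonneg (fejer_nonneg m θ) q),
    ← intervalIntegral.integral_of_le Real.pi_pos.le]
  exact ENNReal.ofReal_le_ofReal (integral_fejer_rpow_le hm hq)

/-- Hölder's inequality with exponents inversely proportional to `m k ^ 2 - 1`. -/
theorem integral_prod_fejer_le {n : ℕ} (m : Fin n → ℕ) (hm : ∀ k, 1 ≤ m k) :
    ∫ θ in (0 : ℝ)..Real.pi, ∏ k, fejer (m k) θ ≤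
      Real.pi / √(1 + ∑ k, ((m k : ℝ) ^ 2 - 1)) := by
  have hpi := Real.pi_pos
  set v : Fin n → ℝ := fun k => (m k : ℝ) ^ 2 - 1 with hv
  set V := ∑ k, v k with hV
  have hm1 : ∀ k, (1 : ℝ) ≤ m k := fun k => by exact_mod_cast hm k
  have hv0 : ∀ k, 0 ≤ v k := fun k => by have := hm1 k; simp only [hv]; nlinarith
  have hV0 : 0 ≤ V := Finset.sum_nonneg fun k _ => hv0 k
  have hprod0 : ∀ θ, 0 ≤ ∏ k, fejer (m k) θ := fun θ =>
    Finset.prod_nonneg fun k _ => fejer_nonneg _ _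
  have hprod1 : ∀ θ, ∏ k, fejer (m k) θ ≤ 1 := fun θ =>
    Finset.prod_le_one (fun k _ => fejer_nonneg _ _) fun k _ => fejer_le_one _ _
  have hmeas : Measurable fun θ => ∏ k, fejer (m k) θ :=
    Finset.measurable_prod _ fun k _ => measurable_fejer (m k)
  have hint : IntervalIntegrable (fun θ => ∏ k, fejer (m k) θ) volume 0 Real.pi := by
    refine (intervalIntegrable_const (c := (1 : ℝ))).mono_fun
      hmeas.aestronglyMeasurable (Filter.Eventually.of_forall fun θ => ?_)
    change ‖∏ k, fejer (m k) θ‖ ≤ ‖(1 : ℝ)‖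
    rw [Real.norm_of_nonneg (hprod0 θ), norm_one]
    exact hprod1 θ
  rcases hV0.eq_or_lt with hV0 | hVpos
  · rw [← hV0]
    have := intervalIntegral.integral_mono_on hpi.le hint
      (intervalIntegrable_const (c := (1 : ℝ))) fun θ _ => hprod1 θ
    simpa using this
  set c := Real.pi / √(1 + V) with hc
  have hc0 : 0 < c := div_pos hpi (Real.sqrt_pos.mpr (by linarith))
  set p : Fin n → ℝ := fun k => v k / V with hp
  have hp0 : ∀ k, 0 ≤ p k := fun k => div_nonneg (hv0 k) hVpos.le
  have hp1 : ∑ k, p k = 1 := by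
    simp only [hp]; rw [← Finset.sum_div, ← hV, div_self hVpos.ne']
  have hple : ∀ k, p k ≤ 1 := fun k => by
    rw [← hp1]; exact Finset.single_le_sum (fun j _ => hp0 j) (Finset.mem_univ k)
  set f : Fin n → ℝ → ENNReal := fun k θ => ENNReal.ofReal (fejer (m k) θ ^ (p k)⁻¹) with hf
  have hfm : ∀ k, Measurable (f k) := fun k =>
    ((measurable_fejer (m k)).pow_const _).ennreal_ofReal
  have hpt : ∀ θ, ENNReal.ofReal (∏ k, fejer (m k) θ) ≤ ∏ k, f k θ ^ p k := by
    intro θ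
    rw [ENNReal.ofReal_prod_of_nonneg fun k _ => fejer_nonneg _ _]
    refine Finset.prod_le_prod' fun k _ => ?_
    have h0 := fejer_nonneg (m k) θ
    rcases (hp0 k).eq_or_lt with h | h
    · rw [← h, ENNReal.rpow_zero]
      exact ENNReal.ofReal_le_one.mpr (fejer_le_one _ _)
    · simp only [hf]
      rw [ENNReal.ofReal_rpow_of_nonneg (Real.rpow_nonneg h0 _) h.le, ← Real.rpow_mul h0,
        inv_mul_cancel₀ h.ne', Real.rpow_one]
  have hbound : ∀ k, (∫⁻ θ in Set.Ioc 0 Real.pi, f k θ) ^ p k ≤ ENNReal.ofReal (c ^ p k) := by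
    intro k
    rcases (hp0 k).eq_or_lt with h | h
    · rw [← h, ENNReal.rpow_zero, Real.rpow_zero, ENNReal.ofReal_one]
    · rw [← ENNReal.ofReal_rpow_of_pos hc0]
      refine ENNReal.rpow_le_rpow ?_ h.le
      have hvk : 0 < v k := by
        by_contra hneg
        have : v k = 0 := le_antisymm (not_lt.mp hneg) (hv0 k)
        simp [hp, this] at h
      have h2 : 2 ≤ m k := by
        by_contra hneg
        have : m k = 1 := by have := hm k; omega
        simp [hv, this] at hvk
      refine (lintegral_fejer_rpow_le h2 ((one_le_inv₀ h).mpr (hple k))).trans_eq ?_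
      have : (p k)⁻¹ * ((m k : ℝ) ^ 2 - 1) = V := by
        simp only [hp]
        change (v k / V)⁻¹ * v k = V
        field_simp
      rw [this]
  have hmain : ∫⁻ θ in Set.Ioc 0 Real.pi, ENNReal.ofReal (∏ k, fejer (m k) θ) ≤
      ENNReal.ofReal c := by
    calc _ ≤ ∫⁻ θ in Set.Ioc 0 Real.pi, ∏ k, f k θ ^ p k := lintegral_mono hpt
      _ ≤ ∏ k, (∫⁻ θ in Set.Ioc 0 Real.pi, f k θ) ^ p k :=
          ENNReal.lintegral_prod_norm_pow_le _ (fun k _ => (hfm k).aemeasurable) hp1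
            fun k _ => hp0 k
      _ ≤ ∏ k, ENNReal.ofReal (c ^ p k) := Finset.prod_le_prod' fun k _ => hbound k
      _ = ENNReal.ofReal c := by
          rw [← ENNReal.ofReal_prod_of_nonneg fun k _ => Real.rpow_nonneg hc0.le _,
            ← Real.rpow_sum_of_pos hc0, hp1, Real.rpow_one]
  rw [intervalIntegral.integral_of_le hpi.le, integral_eq_lintegral_of_nonneg_ae
    (Filter.Eventually.of_forall hprod0) hmeas.aestronglyMeasurable]
  exact ENNReal.toReal_le_of_le_ofReal hc0.le hmain

theorem tsum_repCount_ofFn_sq_le {n : ℕ} (S : Fin n → Finset ℤ) (hS : ∀ k, (S k).Nonempty) :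
    ∑' x, (repCount (List.ofFn S) x : ℝ) ^ 2 ≤
      (∏ k, ((S k).card : ℝ)) ^ 2 / √(1 + ∑ k, (((S k).card : ℝ) ^ 2 - 1)) := by
  have hpi := Real.pi_pos
  have h1 := tsum_repCount_sq_le (List.ofFn S)
  have h2 := integral_prod_fejer ((List.ofFn S).map Finset.card)
  have h3 := integral_prod_fejer_le (fun k => (S k).card) fun k => (hS k).card_pos
  have h4 : ∀ θ : ℝ, (((List.ofFn S).map Finset.card).map
      fun m : ℕ => (Real.sin (m * θ) / Real.sin θ) ^ 2).prod =
      (∏ k, ((S k).card : ℝ)) ^ 2 * ∏ k, fejer (S k).card θ := by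
    intro θ
    rw [List.map_map, List.map_ofFn, List.prod_ofFn, ← Finset.prod_pow, ← Finset.prod_mul_distrib]
    refine Finset.prod_congr rfl fun k _ => ?_
    have : ((S k).card : ℝ) ≠ 0 := by exact_mod_cast (hS k).card_pos.ne'
    simp only [Function.comp, fejer]
    rw [div_pow, div_pow, mul_pow, mul_div_assoc', mul_div_mul_left _ _ (by positivity)]
  simp only [h4] at h2
  rw [intervalIntegral.integral_const_mul] at h2
  refine h1.trans ?_
  refine le_of_mul_le_mul_left ?_ hpi
  rw [← h2]
  calc (∏ k, ((S k).card : ℝ)) ^ 2 * ∫ θ in (0 : ℝ)..Real.pi, ∏ k, fejer (S k).card θ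
      ≤ (∏ k, ((S k).card : ℝ)) ^ 2 *
        (Real.pi / √(1 + ∑ k, (((S k).card : ℝ) ^ 2 - 1))) := by gcongr
    _ = _ := by ring

/-! ### Rényi entropies of sums of independent uniform variables -/

lemma summable_repCount (L : List (Finset ℤ)) : Summable fun x => (repCount L x : ℝ) :=
  summable_of_hasFiniteSupport ((finite_support_repCount L).subset fun x hx => by
    intro h; exact hx (by simp [h]))

lemma tsum_repCount (L : List (Finset ℤ)) :
    ∑' x, (repCount L x : ℝ) = (L.map fun A => (A.card : ℝ)).prod := by
  induction L with
  | nil =>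
    rw [tsum_eq_single 0 (fun x hx => by simp [repCount, hx])]
    simp [repCount]
  | cons A L ih =>
    have hshift : ∀ a : ℤ, (fun x : ℤ => (repCount L (x - a) : ℝ)) =
        (fun x => (repCount L x : ℝ)) ∘ Equiv.subRight a := fun a => by
      funext x; simp [Equiv.subRight_apply]
    simp only [repCount, Nat.cast_sum]
    rw [Summable.tsum_finsetSum fun a _ => by
      rw [hshift]; exact (Equiv.summable_iff _).mpr (summable_repCount L)]
    have h : ∀ a : ℤ, ∑' x : ℤ, (repCount L (x - a) : ℝ) =
        (L.map fun A => (A.card : ℝ)).prod := fun a => by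
      rw [← ih, hshift]
      exact (Equiv.subRight a).tsum_eq (fun x => (repCount L x : ℝ))
    simp [h]

lemma measureReal_preimage_singleton_of_hasLaw {Ω : Type*} [MeasurableSpace Ω] {μ : Measure Ω}
    {S : Finset ℤ} {X : Ω → ℤ} (hX : HasLaw X (uniformOn (S : Set ℤ)) μ) (x : ℤ) :
    μ.real (X ⁻¹' {x}) = if x ∈ S then 1 / (S.card : ℝ) else 0 := by
  classical
  have h : μ (X ⁻¹' {x}) = uniformOn (S : Set ℤ) {x} := hX.measure_eq (p := fun y => y = x)
    (measurableSet_singleton x)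
  rw [measureReal_def, h, show ({x} : Set ℤ) = (({x} : Finset ℤ) : Set ℤ) by simp,
    uniformOn_apply_finset]
  split_ifs with hx
  · rw [Finset.inter_singleton_of_mem hx]; simp
  · rw [Finset.inter_singleton_of_notMem hx]; simp

/-- The law of a sum of independent uniform variables in terms of representation counts. -/
lemma measureReal_sum_eq {Ω : Type*} [MeasurableSpace Ω] (μ : Measure Ω) [IsProbabilityMeasure μ]
    {n : ℕ} (S : Fin n → Finset ℤ) (hS : ∀ k, (S k).Nonempty) (U : Fin n → Ω → ℤ)
    (hU : ∀ k, HasLaw (U k) (uniformOn (S k : Set ℤ)) μ) (hind : iIndepFun U μ) (x : ℤ) :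
    μ.real ((fun ω => ∑ k, U k ω) ⁻¹' {x}) =
      repCount (List.ofFn S) x / ∏ k, ((S k).card : ℝ) := by
  induction n generalizing x with
  | zero =>
    rcases eq_or_ne x 0 with rfl | hx
    · simp [repCount]
    · have : (fun _ : Ω => (0 : ℤ)) ⁻¹' {x} = ∅ := by
        ext ω; simp [hx.symm]
      simp [repCount, hx, this]
  | succ n ih =>
    have hm : ∀ k, AEMeasurable (U k) μ := fun k => (hU k).aemeasurable
    set Y : Ω → ℤ := fun ω => ∑ k : Fin n, U k.succ ω with hY
    have hYm : AEMeasurable Y μ := Finset.aemeasurable_fun_sum _ fun k _ => hm k.succ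
    have hYlaw := ih (fun k => S k.succ) (fun k => hS k.succ) (fun k => U k.succ)
      (fun k => hU k.succ) (hind.precomp (Fin.succ_injective n))
    have hindY : IndepFun (U 0) Y μ := by
      have := (hind.indepFun_finsetSum_of_notMem₀ hm
        (s := Finset.univ.image Fin.succ) (i := 0) (by simp)).symm
      rw [Finset.sum_image (fun a _ b _ h => Fin.succ_injective n h)] at this
      convert this using 1
      funext ω
      simp [hY]
    have hae : ∀ᵐ ω ∂μ, U 0 ω ∈ S 0 := by
      have hprob : IsProbabilityMeasure (uniformOn (S 0 : Set ℤ)) :=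
        isProbabilityMeasure_uniformOn (S 0).finite_toSet (hS 0)
      have h1 : ∀ᵐ y ∂(uniformOn (S 0 : Set ℤ)), y ∈ (S 0 : Set ℤ) := by
        rw [ae_iff]
        have := uniformOn_self (S 0).finite_toSet (hS 0)
        exact (prob_compl_eq_zero_iff (S 0).measurableSet).mpr this
      rw [← (hU 0).map_eq] at h1
      exact ae_of_ae_map (hm 0) h1
    have hset : (fun ω => ∑ k, U k ω) ⁻¹' {x} =ᵐ[μ]
        (⋃ a ∈ S 0, U 0 ⁻¹' {a} ∩ Y ⁻¹' {x - a} : Set Ω) := by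
      filter_upwards [hae] with ω hω
      refine propext ⟨fun h => ?_, fun h => ?_⟩
      · have h' : ∑ k, U k ω = x := h
        rw [Fin.sum_univ_succ] at h'
        refine Set.mem_biUnion hω ⟨rfl, ?_⟩
        change Y ω = x - U 0 ω
        simp only [hY]
        linarith
      · obtain ⟨a, -, ha, hy⟩ := Set.mem_iUnion₂.mp h
        have ha' : U 0 ω = a := ha
        have hy' : Y ω = x - a := hy
        change ∑ k, U k ω = x
        rw [Fin.sum_univ_succ, ha']
        simp only [hY] at hy'
        linarith
    have hnull : ∀ a ∈ S 0, NullMeasurableSet (U 0 ⁻¹' {a} ∩ Y ⁻¹' {x - a}) μ := fun a _ =>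
      ((hm 0).nullMeasurableSet_preimage (measurableSet_singleton a)).inter
        (hYm.nullMeasurableSet_preimage (measurableSet_singleton _))
    have hdisj : Set.Pairwise (↑(S 0))
        (Function.onFun (AEDisjoint μ) fun a => U 0 ⁻¹' {a} ∩ Y ⁻¹' {x - a}) := by
      intro a _ b _ hab
      refine Disjoint.aedisjoint (Set.disjoint_left.mpr fun ω h1 h2 => hab ?_)
      have h1' : U 0 ω = a := h1.1
      have h2' : U 0 ω = b := h2.1
      rw [← h1', h2']
    have hterm : ∀ a ∈ S 0, (μ (U 0 ⁻¹' {a} ∩ Y ⁻¹' {x - a})).toReal =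
        1 / ((S 0).card : ℝ) *
          (repCount (List.ofFn fun k => S k.succ) (x - a) / ∏ k : Fin n, ((S k.succ).card : ℝ)) := by
      intro a ha
      rw [hindY.measure_inter_preimage_eq_mul _ _ (measurableSet_singleton _)
        (measurableSet_singleton _), ENNReal.toReal_mul, ← measureReal_def, ← measureReal_def,
        hYlaw, measureReal_preimage_singleton_of_hasLaw (hU 0), if_pos ha]
    rw [measureReal_def, measure_congr hset, measure_biUnion_finset₀ hdisj hnull,
      ENNReal.toReal_sum fun a _ => measure_ne_top _ _, Finset.sum_congr rfl hterm,
      List.ofFn_succ, repCount, Fin.prod_univ_succ, ← Finset.mul_sum, ← Finset.sum_div]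
    push_cast
    rw [div_mul_div_comm, one_mul]

/-- Bernoulli's inequality for nonpositive exponents. -/
lemma one_add_mul_sub_one_le_rpow {s t : ℝ} (hs : s ≤ 0) (ht : 0 < t) :
    1 + s * (t - 1) ≤ t ^ s := by
  rw [Real.rpow_def_of_pos ht]
  have h1 := Real.log_le_sub_one_of_pos ht
  have h2 := Real.add_one_le_exp (Real.log t * s)
  nlinarith

/-- The Rényi entropy of order `α ≤ 2` is at least the one of order `2`. -/
theorem neg_log_tsum_sq_le_renyiEntropy {Ω I : Type*} [MeasurableSpace Ω] {μ : Measure Ω}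
    {X : Ω → I} (hfin : (Function.support (probMass μ X)).Finite)
    (hsum : ∑' x, probMass μ X x = 1) {α : ℝ} (hα : α ≤ 2) :
    -Real.log (∑' x, probMass μ X x ^ 2) ≤ renyiEntropy α μ X := by
  set p := probMass μ X with hp
  have hp0 : ∀ x, 0 ≤ p x := fun x => measureReal_nonneg
  set T := hfin.toFinset with hT
  have hmem : ∀ x, x ∈ T ↔ p x ≠ 0 := fun x => by simp [hT]
  have hpos : ∀ x ∈ T, 0 < p x := fun x hx => (hp0 x).lt_of_ne' ((hmem x).mp hx)
  have htsum : ∀ g : I → ℝ, (∀ x, p x = 0 → g x = 0) → ∑' x, g x = ∑ x ∈ T, g x :=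
    fun g hg => tsum_eq_sum fun x hx => hg x (by by_contra h; exact hx ((hmem x).mpr h))
  have hsumT : ∑ x ∈ T, p x = 1 := by rw [← htsum p fun _ h => h, hsum]
  have hTne : T.Nonempty := by
    by_contra h
    rw [Finset.not_nonempty_iff_eq_empty] at h
    rw [h, Finset.sum_empty] at hsumT
    norm_num at hsumT
  rw [htsum (fun x => p x ^ 2) fun x h => by simp [h]]
  set M := ∑ x ∈ T, p x ^ 2 with hM
  have hM0 : 0 < M := Finset.sum_pos (fun x hx => pow_pos (hpos x hx) 2) hTne
  -- the tangent line at `M`, averaged with the weights `p`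
  have hlin : ∀ s : ℝ, ∑ x ∈ T, p x * (1 + s * (p x / M - 1)) = 1 := by
    intro s
    have h1 : ∀ x ∈ T, p x * (1 + s * (p x / M - 1)) = (1 - s) * p x + s / M * p x ^ 2 :=
      fun x _ => by ring
    rw [Finset.sum_congr rfl h1, Finset.sum_add_distrib, ← Finset.mul_sum, ← Finset.mul_sum,
      hsumT, ← hM]
    field_simp
    ring
  have hpow : ∀ x ∈ T, p x * (p x / M) ^ (α - 1) = M ^ (1 - α) * p x ^ α := by
    intro x hx
    have hx := hpos x hx
    rw [Real.div_rpow hx.le hM0.le, Real.rpow_sub hx, Real.rpow_one,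
      show 1 - α = -(α - 1) by ring, Real.rpow_neg hM0.le]
    field_simp
  have hsumpos : 0 < ∑ x ∈ T, p x ^ α :=
    Finset.sum_pos (fun x hx => Real.rpow_pos_of_pos (hpos x hx) _) hTne
  have hlog : Real.log (M ^ (1 - α) * ∑ x ∈ T, p x ^ α) =
      (1 - α) * Real.log M + Real.log (∑ x ∈ T, p x ^ α) := by
    rw [Real.log_mul (Real.rpow_pos_of_pos hM0 _).ne' hsumpos.ne', Real.log_rpow hM0]
  have hlow : α ≤ 1 → 0 ≤ (1 - α) * Real.log M + Real.log (∑ x ∈ T, p x ^ α) := by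
    intro h
    rw [← hlog]
    refine Real.log_nonneg ?_
    rw [Finset.mul_sum, ← Finset.sum_congr rfl hpow]
    refine (hlin (α - 1)).symm.trans_le ?_
    exact Finset.sum_le_sum fun x hx => mul_le_mul_of_nonneg_left
      (one_add_mul_sub_one_le_rpow (by linarith) (div_pos (hpos x hx) hM0)) (hp0 x)
  have hhigh : 1 ≤ α → (1 - α) * Real.log M + Real.log (∑ x ∈ T, p x ^ α) ≤ 0 := by
    intro h
    rw [← hlog]
    refine Real.log_nonpos (mul_pos (Real.rpow_pos_of_pos hM0 _) hsumpos).le ?_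
    rw [Finset.mul_sum, ← Finset.sum_congr rfl hpow]
    refine le_trans ?_ (hlin (α - 1)).le
    refine Finset.sum_le_sum fun x hx => mul_le_mul_of_nonneg_left ?_ (hp0 x)
    have := rpow_one_add_le_one_add_mul_self (s := p x / M - 1)
      (by linarith [div_pos (hpos x hx) hM0]) (p := α - 1) (by linarith) (by linarith)
    simpa using this
  unfold renyiEntropy
  rw [← hp]
  split_ifs with h0 h1
  · have h := hlow (by linarith)
    rw [h0] at h
    simp only [Real.rpow_zero, Finset.sum_const, nsmul_eq_mul, mul_one, sub_zero, one_mul] at h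
    rw [Set.ncard_eq_toFinset_card _ hfin]
    linarith
  · rw [htsum (fun x => p x * Real.log (p x)) fun x h => by simp [h]]
    refine neg_le_neg ?_
    have h2 : ∀ x ∈ T, p x * Real.log (p x) ≤
        p x * Real.log M + (p x * (1 + 1 * (p x / M - 1)) - p x) := by
      intro x hx
      have hx := hpos x hx
      have h3 := Real.log_le_sub_one_of_pos (div_pos hx hM0)
      rw [Real.log_div hx.ne' hM0.ne'] at h3
      nlinarith
    refine (Finset.sum_le_sum h2).trans_eq ?_
    rw [Finset.sum_add_distrib, Finset.sum_sub_distrib, hlin 1, ← Finset.sum_mul, hsumT]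
    ring
  · rw [htsum (fun x => p x ^ α) fun x h => by simp [h, Real.zero_rpow h0]]
    rw [one_div, inv_mul_eq_div]
    rcases lt_or_gt_of_ne h1 with h | h
    · rw [le_div_iff₀ (by linarith)]
      linarith [hlow h.le]
    · rw [le_div_iff_of_neg (by linarith)]
      linarith [hhigh h.le]

/-- The Rényi entropy power of a uniform variable does not depend on the order. -/
lemma renyiEntropyPower_of_uniform {Ω : Type*} [MeasurableSpace Ω] {μ : Measure Ω} {S : Finset ℤ}
    (hS : S.Nonempty) {X : Ω → ℤ} (hX : HasLaw X (uniformOn (S : Set ℤ)) μ) (α : ℝ) :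
    renyiEntropyPower α μ X = (S.card : ℝ) ^ 2 := by
  have hc : (0 : ℝ) < S.card := by exact_mod_cast hS.card_pos
  have hp : probMass μ X = fun x => if x ∈ S then 1 / (S.card : ℝ) else 0 :=
    funext fun x => measureReal_preimage_singleton_of_hasLaw hX x
  have hsum : ∀ g : ℝ → ℝ, g 0 = 0 →
      ∑' x, g (probMass μ X x) = S.card * g (1 / S.card) := by
    intro g hg
    have hg' : ∀ x ∈ S, g (probMass μ X x) = g (1 / S.card) := fun x hx => by simp [hp, hx]
    rw [tsum_eq_sum (s := S) fun x hx => by simp [hp, hx, hg], Finset.sum_congr rfl hg',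
      Finset.sum_const, nsmul_eq_mul]
  have h : renyiEntropy α μ X = Real.log S.card := by
    unfold renyiEntropy
    split_ifs with h0 h1
    · have : Function.support (probMass μ X) = S := by
        ext x
        simp [hp, hc.ne']
      rw [this, Set.ncard_coe_finset]
    · rw [hsum (fun y => y * Real.log y) (by simp), one_div, Real.log_inv]
      field_simp
    · rw [hsum (fun y => y ^ α) (Real.zero_rpow h0)]
      have : (S.card : ℝ) * (1 / (S.card : ℝ)) ^ α = (S.card : ℝ) ^ (1 - α) := by
        rw [one_div, Real.inv_rpow hc.le, Real.rpow_sub hc, Real.rpow_one, div_eq_mul_inv]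
      rw [this, Real.log_rpow hc]
      have : 1 - α ≠ 0 := sub_ne_zero.mpr (Ne.symm h1)
      field_simp
  rw [renyiEntropyPower, h, two_mul, Real.exp_add, Real.exp_log hc, sq]

theorem theorem1p4 {Ω : Type*} [MeasurableSpace Ω] (μ : Measure Ω) [IsProbabilityMeasure μ]
    (α : ℝ) (hα : α ∈ Set.Icc (0 : ℝ) 2) (n : ℕ) (hn : 1 ≤ n)
    (S : Fin n → Finset ℤ) (hS : ∀ k, (S k).Nonempty) (U : Fin n → Ω → ℤ)
    (hU : ∀ k, HasLaw (U k) (uniformOn (S k : Set ℤ)) μ) (hind : iIndepFun U μ) :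
    renyiEntropyPower α μ (fun ω => ∑ k, U k ω) ≥
      (∑ k, renyiEntropyPower α μ (U k)) - ((n : ℝ) - 1) := by
  set N : ℝ := ∏ k, ((S k).card : ℝ) with hN
  have hN0 : 0 < N := Finset.prod_pos fun k _ => by exact_mod_cast (hS k).card_pos
  set D : ℝ := 1 + ∑ k, (((S k).card : ℝ) ^ 2 - 1) with hD
  have hD0 : 0 < D := by
    have : 0 ≤ ∑ k, (((S k).card : ℝ) ^ 2 - 1) := Finset.sum_nonneg fun k _ => by
      have h1 : (1 : ℝ) ≤ (S k).card := by exact_mod_cast (hS k).card_pos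
      nlinarith
    linarith
  have hp : ∀ x, probMass μ (fun ω => ∑ k, U k ω) x = repCount (List.ofFn S) x / N :=
    fun x => measureReal_sum_eq μ S hS U hU hind x
  have hfin : (Function.support (probMass μ fun ω => ∑ k, U k ω)).Finite :=
    (finite_support_repCount (List.ofFn S)).subset fun x hx h => hx (by rw [hp, h]; simp)
  have hsum : ∑' x, probMass μ (fun ω => ∑ k, U k ω) x = 1 := by
    simp only [hp]
    rw [tsum_div_const, tsum_repCount, List.map_ofFn, List.prod_ofFn]
    exact div_self hN0.ne'
  have hsq : ∑' x, probMass μ (fun ω => ∑ k, U k ω) x ^ 2 ≤ 1 / √D := by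
    simp only [hp, div_pow]
    rw [tsum_div_const, div_le_iff₀ (by positivity)]
    refine (tsum_repCount_ofFn_sq_le S hS).trans_eq ?_
    rw [← hN, ← hD]; ring
  have hsq0 : 0 < ∑' x, probMass μ (fun ω => ∑ k, U k ω) x ^ 2 := by
    obtain ⟨x, hx⟩ : ∃ x, probMass μ (fun ω => ∑ k, U k ω) x ≠ 0 := by
      by_contra! h
      simp [h] at hsum
    refine Summable.tsum_pos (summable_of_hasFiniteSupport (hfin.subset fun y hy h => hy ?_))
      (fun y => sq_nonneg _) x (by positivity)
    simp [h]
  have hH := neg_log_tsum_sq_le_renyiEntropy hfin hsum hα.2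
  have hlog : Real.log D / 2 ≤ renyiEntropy α μ fun ω => ∑ k, U k ω := by
    refine le_trans ?_ hH
    have h1 := Real.log_le_log hsq0 hsq
    rw [one_div, Real.log_inv, Real.log_sqrt hD0.le] at h1
    linarith
  have hpower : D ≤ renyiEntropyPower α μ fun ω => ∑ k, U k ω := by
    rw [renyiEntropyPower, ← Real.log_le_iff_le_exp hD0]
    linarith
  have hrhs : (∑ k, renyiEntropyPower α μ (U k)) - ((n : ℝ) - 1) = D := by
    rw [hD, Finset.sum_congr rfl fun k _ => renyiEntropyPower_of_uniform (hS k) (hU k) α,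
      Finset.sum_sub_distrib]
    simp
    ring
  rw [hrhs]
  exact hpower
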